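/- Let $m \ge 0$ and let $K$ be an abstract simplicial complex on the vertex set $[m]=\{1,\dots,m\}$, i.e. a family of subsets of $[m]$ that contains $\emptyset$ and is closed under passing to subsets (a singleton $\{i\}$ need not belong to $K$). For $n\ge -1$ let $t_n$ be the number of $n$-simplices of $K$, i.e. of elements of $K$ with $n+1$ elements, so $t_{-1}=1$. Let $D^1=[-1,1]$, $S^0=\{-1,1\}$, and let $$Z(K;(D^1,S^0))=\bigcup_{\sigma\in K}\{x\in (D^1)^m : x_i\in S^0 \text{ for all } i\notin\sigma\}\subset (D^1)^m .$$ Then the singular homology groups $H_i(Z(K;(D^1,S^0));\mathbb Z)$ are finitely generated, only finitely many are nonzero, and the Euler characteristic $\chi=\sum_i(-1)^i\operatorname{rank}H_i$ is $$\chi\bigl(Z(K;(D^1,S^0))\bigr)=\sum_{n=-1}^{m-1}(-1)^{n+1}\,t_n\,2^{m-n-1}.$$ Moreover, if $n\ge 3$ and $K$ is the boundary of an $n$-gon (vertices $1,\dots,n$ in cyclic order, with the $n$ edges joining neighbours as its $1$-simplices), then $Z(K;(D^1,S^0))$ is a closed connected orientable surface of genus $1+(n-4)2^{n-3}$, where the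 genus $g$ of a closed connected orientable surface $S$ is given by $\chi(S)=2-2g$. -/

import Mathlib

open scoped Manifold ContDiff

noncomputable section

/-! ### Simplices, and the boundary of a polygon -/

/-- The simplices of `K`, the empty simplex included. (In Mathlib the empty set is never a face of
a `PreAbstractSimplicialComplex`; not every element of `V` has to be a `0`-simplex.) -/
def PreAbstractSimplicialComplex.simplices {V : Type*} (K : PreAbstractSimplicialComplex V) :
    Set (Finset V) :=
  insert ∅ K.faces

/-- The number `t_n` of `n`-simplices of `K`, for an integer `n`; an `n`-simplex has `n + 1`
elements, and the empty simplex is the only `(-1)`-simplex. -/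
def PreAbstractSimplicialComplex.numSimplices {V : Type*} (K : PreAbstractSimplicialComplex V)
    (n : ℤ) : ℕ :=
  {σ : Finset V | σ ∈ K.simplices ∧ (σ.card : ℤ) = n + 1}.ncard

/-- The boundary of an `n`-gon (`n ≥ 3`) as a simplicial complex on its vertices `0, …, n - 1`, in
cyclic order: the nonempty faces are the vertices and the edges between neighbours. -/
def polygonBoundary (n : ℕ) : PreAbstractSimplicialComplex (Fin n) where
  faces := {s | (∃ i, s = {i}) ∨ ∃ i j, (SimpleGraph.cycleGraph n).Adj i j ∧ s = {i, j}}
  isRelLowerSet_faces := by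
    rintro s (⟨i, rfl⟩ | ⟨i, j, hij, rfl⟩)
    · refine ⟨by simp, fun t hts ht => Or.inl ⟨i, ?_⟩⟩
      exact (Finset.Nonempty.subset_singleton_iff ht).1 hts
    · refine ⟨by simp, fun t hts ht => ?_⟩
      have hts' : t ⊆ {i, j} := hts
      by_cases hi : i ∈ t
      · by_cases hj : j ∈ t
        · refine Or.inr ⟨i, j, hij, Finset.Subset.antisymm hts' ?_⟩
          intro k hk
          rcases Finset.mem_insert.1 hk with rfl | hk
          · exact hi
          · rwa [Finset.mem_singleton.1 hk]
        · refine Or.inl ⟨i, (Finset.Nonempty.subset_singleton_iff ht).1 fun k hk => ?_⟩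
          rcases Finset.mem_insert.1 (hts' hk) with h | h
          · simp [h]
          · exact absurd (Finset.mem_singleton.1 h ▸ hk) hj
      · refine Or.inl ⟨j, (Finset.Nonempty.subset_singleton_iff ht).1 fun k hk => ?_⟩
        rcases Finset.mem_insert.1 (hts' hk) with h | h
        · exact absurd (h ▸ hk) hi
        · exact h

/-! ### Polyhedral products -/

/-- The polyhedral product `Z(K; (X, A)) = ⋃_{σ ∈ K} D(σ)` as a subspace of `∏ X_i`, where
`D(σ) = ∏ Y_i` with `Y_i = X_i` for `i ∈ σ` and `Y_i = A_i` for `i ∉ σ`. -/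
def polyhedralProduct {V : Type*} (K : PreAbstractSimplicialComplex V) (X : V → Type*)
    (A : ∀ i, Set (X i)) : Set (∀ i, X i) :=
  ⋃ σ ∈ K.simplices, {x | ∀ i, i ∉ σ → x i ∈ A i}

/-- The disc `D¹ = [-1, 1]`. -/
abbrev OneDisc : Type := Set.Icc (-1 : ℝ) 1

/-- The sphere `S⁰ = {-1, 1}`, the boundary of `D¹`. -/
def zeroSphere : Set OneDisc := {x | (x : ℝ) = -1 ∨ (x : ℝ) = 1}

/-- The real moment-angle complex `Z(K; (D¹, S⁰))`, with the topology of a subspace of the cube. -/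
abbrev RealMomentAngleComplex {m : ℕ} (K : PreAbstractSimplicialComplex (Fin m)) : Type :=
  polyhedralProduct K (fun _ => OneDisc) (fun _ => zeroSphere)

/-! ### The Euler characteristic of a space -/

/-- The singular homology group `H_i(X; ℤ)`. -/
abbrev integralHomology (X : Type) [TopologicalSpace X] (i : ℕ) : ModuleCat.{0} ℤ :=
  ((AlgebraicTopology.singularHomologyFunctor (ModuleCat.{0} ℤ) i).obj (ModuleCat.of ℤ ℤ)).obj
    (TopCat.of X)

/-- All `H_i(X; ℤ)` are finitely generated and only finitely many of them are nonzero: the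
condition under which the Euler characteristic of `X` is meaningful. -/
structure HasFiniteHomology (X : Type) [TopologicalSpace X] : Prop where
  finite (i : ℕ) : Module.Finite ℤ (integralHomology X i)
  bounded : {i : ℕ | Nontrivial (integralHomology X i)}.Finite

/-- The Euler characteristic `χ(X) = ∑ i, (-1) ^ i * rank H_i(X; ℤ)`. -/
def eulerCharacteristic (X : Type) [TopologicalSpace X] : ℤ :=
  GradedObject.eulerChar (ComplexShape.down ℕ) (fun i => integralHomology X i)

/-! ### Orientable surfaces and their genus -/

/-- `X` is a closed connected orientable surface: a nonempty compact connected Hausdorff space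
which has a smooth atlas of charts in the plane whose transition maps have positive Jacobian
determinant everywhere. (A space with a finite atlas of such charts is second countable. Every
topological surface has a smooth structure, so no orientable topological surface is left out.) -/
structure IsClosedOrientableSurface (X : Type) [TopologicalSpace X] : Prop where
  compact : CompactSpace X
  connected : ConnectedSpace X
  hausdorff : T2Space X
  oriented_atlas : ∃ cs : ChartedSpace (EuclideanSpace ℝ (Fin 2)) X,
    IsManifold (𝓡 2) ∞ X ∧
      ∀ e ∈ cs.atlas, ∀ e' ∈ cs.atlas, ∀ x ∈ (e.symm.trans e').source,
        0 < (fderiv ℝ (e.symm.trans e') x).det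

/-- `X` is a closed connected orientable surface of genus `g`, the genus of such a surface being
determined by `χ(X) = 2 - 2 g`. -/
structure IsSurfaceOfGenus (X : Type) [TopologicalSpace X] (g : ℕ) : Prop where
  surface : IsClosedOrientableSurface X
  finite_homology : HasFiniteHomology X
  euler : eulerCharacteristic X = 2 - 2 * (g : ℤ)

end

/-!
The proof has two independent halves.

*Euler characteristic.* For an arbitrary lower family `F` of subsets of `Fin m`, the cubical
subspace `cubeSubset F` of the cube is the union of the open parts where the first coordinate is
`> -1` and `< 1`. Moving the first coordinate to `1`, to `-1` or to `0` shows that the two parts and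
their intersection are homotopy equivalent to the subspaces of a cube of dimension `m - 1` which
belong to the deletion, the deletion and the link of the first vertex. Hence
`χ(F) = 2 χ(deletion F) - χ(linkZero F)`, and the alternating number of cubes satisfies the same
recursion (`hasEuler_cubeSubset`). The input is inclusion-exclusion for the Euler characteristic of
a union of two open sets (`HasEuler.union`). It is derived from the small simplices theorem:
barycentric subdivision is chain homotopic to the identity and makes every singular chain small
with respect to an open cover, so the complex of chains modulo small chains is acyclic, and Euler
characteristics are additive on short exact sequences of complexes.

*The surface of a polygon.* The charts are indexed by the vertices `v ∈ {±1}ⁿ` of the cube, and are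
defined on their open stars. Near `v` the surface is a union of `n` squares around `v`, which is a
cone on the boundary of an `n`-gon, and the power map with exponent `4 / n` folds each of the `n`
quadrants to a sector of angle `2π / n` (`planeToCone` is the inverse map, from the plane to the
cone). Two different stars meet only away from the vertices. There, the map to the cone is given,
in a half plane along an edge, by the holomorphic power map with exponent `n / 4`, and the half
planes at the two ends of an edge, or at opposite corners of a square, are related by
`z ↦ 2 - conj z`, respectively by `z ↦ 2 + 2 i - z` (`orientedAt_starChart`). So the coordinate
change is smooth, and it preserves the orientation precisely if the two vertices differ in an even
number of coordinates. Reflecting the charts at the vertices with an odd number of negative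
coordinates gives an oriented atlas. The genus then results from counting the simplices of the
polygon.
-/

section

open CategoryTheory Limits Simplicial Opposite

set_option linter.unusedSectionVars false

/-! ### Euler characteristics of short exact sequences of complexes -/

section EulerCharacteristic

variable {R : Type} [CommRing R] [IsDomain R] [IsNoetherianRing R]

/-- A graded module is of finite type if it is finitely generated in each degree and
vanishes in all large degrees. -/
def IsFiniteType (H : ℕ → ModuleCat.{0} R) : Prop :=
  (∀ i, Module.Finite R (H i)) ∧ ∃ N, ∀ i, N ≤ i → Subsingleton (H i)

/-- The Euler characteristic of a graded module. -/
noncomputable abbrev gradedEuler (H : ℕ → ModuleCat.{0} R) : ℤ :=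
  GradedObject.eulerChar (ComplexShape.down ℕ) H

lemma gradedEuler_eq_sum {H : ℕ → ModuleCat.{0} R} {N : ℕ}
    (hN : ∀ i, N ≤ i → Subsingleton (H i)) :
    gradedEuler H = ∑ i ∈ Finset.range N, (-1 : ℤ) ^ i * Module.finrank R (H i) := by
  rw [gradedEuler, GradedObject.eulerChar_eq_sum_finSet_of_finrankSupport_subset _ _
    (Finset.range N)]
  · simp
  · rw [GradedObject.finrankSupport_subset_iff]
    intro i hi
    have := hN i (by simpa using hi)
    exact Module.finrank_zero_of_subsingleton

/-- The homology of a complex of modules as a graded module. -/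
noncomputable abbrev chainHomology (C : ChainComplex (ModuleCat.{0} R) ℕ) : ℕ → ModuleCat.{0} R :=
  fun i => C.homology i

lemma IsFiniteType.of_iso {H H' : ℕ → ModuleCat.{0} R} (e : ∀ i, H i ≅ H' i)
    (h : IsFiniteType H) : IsFiniteType H' := by
  refine ⟨fun i => ?_, h.2.imp fun N hN i hi => ?_⟩
  · have := h.1 i
    exact Module.Finite.equiv (e i).toLinearEquiv
  · have := hN i hi
    exact (e i).toLinearEquiv.symm.toEquiv.subsingleton

lemma gradedEuler_congr {H H' : ℕ → ModuleCat.{0} R} (e : ∀ i, H i ≅ H' i) :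
    gradedEuler H = gradedEuler H' := by
  unfold gradedEuler GradedObject.eulerChar
  exact finsum_congr fun i => by rw [(e i).toLinearEquiv.finrank_eq]

section LongExact

variable {A B C : ℕ → ModuleCat.{0} R} {f : ∀ i, A i →ₗ[R] B i} {g : ∀ i, B i →ₗ[R] C i}
  {δ : ∀ i, C (i + 1) →ₗ[R] A i}

lemma moduleFinite_of_exact {L M N : Type*} [AddCommGroup L] [AddCommGroup M] [AddCommGroup N]
    [Module R L] [Module R M] [Module R N]
    {u : L →ₗ[R] M} {v : M →ₗ[R] N} (h : Function.Exact u v) [Module.Finite R L]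
    [Module.Finite R N] : Module.Finite R M := by
  have := isNoetherian_of_range_eq_ker u v (h.linearMap_ker_eq.symm)
  infer_instance

lemma subsingleton_of_exact {L M N : Type*} [AddCommGroup L] [AddCommGroup M] [AddCommGroup N]
    [Module R L] [Module R M] [Module R N]
    {u : L →ₗ[R] M} {v : M →ₗ[R] N} (h : Function.Exact u v) [Subsingleton L]
    [Subsingleton N] : Subsingleton M := by
  refine subsingleton_of_forall_eq 0 fun x => ?_
  obtain ⟨y, rfl⟩ := (h x).1 (Subsingleton.elim _ _)
  rw [Subsingleton.elim y 0, map_zero]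

lemma finrank_range_add_finrank_ker_of_isDomain {M N : Type*}
    [AddCommGroup M] [AddCommGroup N] [Module R M] [Module R N] [Module.Finite R M]
    (u : M →ₗ[R] N) :
    Module.finrank R (LinearMap.range u) + Module.finrank R (LinearMap.ker u) =
      Module.finrank R M := by
  rw [← (LinearMap.ker u).finrank_quotient_add_finrank, u.quotKerEquivRange.finrank_eq]

lemma finrank_range_of_surjective {M N : Type*} [AddCommGroup M] [AddCommGroup N]
    [Module R M] [Module R N] {u : M →ₗ[R] N} (hu : Function.Surjective u) :
    Module.finrank R (LinearMap.range u) = Module.finrank R N := by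
  rw [LinearMap.range_eq_top.2 hu, finrank_top]

/-- Additivity of the Euler characteristic along a long exact sequence. -/
lemma gradedEuler_of_longExact (hfg : ∀ i, Function.Exact (f i) (g i))
    (hgδ : ∀ i, Function.Exact (g (i + 1)) (δ i)) (hδf : ∀ i, Function.Exact (δ i) (f i))
    (hg0 : Function.Surjective (g 0))
    (hA : IsFiniteType A) (hB : IsFiniteType B) (hC : IsFiniteType C) :
    gradedEuler B = gradedEuler A + gradedEuler C := by
  have := hA.1
  have := hB.1
  have := hC.1
  obtain ⟨a, ha⟩ := hA.2
  obtain ⟨b, hb⟩ := hB.2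
  obtain ⟨c, hc⟩ := hC.2
  set N := max a (max b c) with hN
  rw [gradedEuler_eq_sum (N := N) fun i hi => ha i (by omega),
    gradedEuler_eq_sum (N := N) fun i hi => hb i (by omega),
    gradedEuler_eq_sum (N := N) fun i hi => hc i (by omega), ← Finset.sum_add_distrib,
    ← sub_eq_zero, ← Finset.sum_sub_distrib]
  -- The alternating sum telescopes with the ranks of the connecting maps.
  let r : ℕ → ℤ := fun i => Nat.casesOn i 0 fun i => Module.finrank R (LinearMap.range (δ i))
  have key : ∀ i, (Module.finrank R (A i) : ℤ) - Module.finrank R (B i) + Module.finrank R (C i)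
      = r (i + 1) + r i := by
    intro i
    have h1 := finrank_range_add_finrank_ker_of_isDomain (f i)
    have h2 := finrank_range_add_finrank_ker_of_isDomain (g i)
    rw [(hδf i).linearMap_ker_eq] at h1
    rw [(hfg i).linearMap_ker_eq] at h2
    have h3 : (Module.finrank R (C i) : ℤ) = r i + Module.finrank R (LinearMap.range (g i)) := by
      cases i with
      | zero =>
        rw [finrank_range_of_surjective hg0]
        simp [r]
      | succ j =>
        have h4 := finrank_range_add_finrank_ker_of_isDomain (δ j)
        rw [(hgδ j).linearMap_ker_eq] at h4
        simp only [r]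
        omega
    have h5 : r (i + 1) = Module.finrank R (LinearMap.range (δ i)) := rfl
    omega
  have tel : ∀ n, ∑ i ∈ Finset.range n, ((-1 : ℤ) ^ i * Module.finrank R (B i) -
      ((-1 : ℤ) ^ i * Module.finrank R (A i) + (-1 : ℤ) ^ i * Module.finrank R (C i)))
      = (-1) ^ n * r n := by
    intro n
    induction n with
    | zero => simp [r]
    | succ n ih =>
      rw [Finset.sum_range_succ, ih, pow_succ]
      linear_combination (-(-1) ^ n) * key n
  rw [tel]
  suffices r N = 0 by rw [this, mul_zero]
  rcases hN' : N with _ | n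
  · rfl
  · have : Subsingleton (C (n + 1)) := hc _ (by omega)
    have : Subsingleton (LinearMap.range (δ n)) := by
      rw [LinearMap.range_eq_bot.2 (LinearMap.ext fun x => by
        rw [Subsingleton.elim x 0, map_zero, map_zero])]
      infer_instance
    simp only [r, Nat.cast_eq_zero]
    exact Module.finrank_zero_of_subsingleton

end LongExact

section ShortExact

variable {S : ShortComplex (ChainComplex (ModuleCat.{0} R) ℕ)}

lemma exists_longExact (hS : S.ShortExact) :
    ∃ (f : ∀ i, chainHomology S.X₁ i →ₗ[R] chainHomology S.X₂ i)
      (g : ∀ i, chainHomology S.X₂ i →ₗ[R] chainHomology S.X₃ i)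
      (δ : ∀ i, chainHomology S.X₃ (i + 1) →ₗ[R] chainHomology S.X₁ i),
      (∀ i, Function.Exact (f i) (g i)) ∧ (∀ i, Function.Exact (g (i + 1)) (δ i)) ∧
      (∀ i, Function.Exact (δ i) (f i)) ∧ Function.Surjective (g 0) := by
  refine ⟨fun i => (HomologicalComplex.homologyMap S.f i).hom,
    fun i => (HomologicalComplex.homologyMap S.g i).hom,
    fun i => (hS.δ (i + 1) i rfl).hom, fun i => ?_, fun i => ?_, fun i => ?_, ?_⟩
  · exact (ShortComplex.ShortExact.moduleCat_exact_iff_function_exact _).1 (hS.homology_exact₂ i)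
  · exact (ShortComplex.ShortExact.moduleCat_exact_iff_function_exact _).1
      (hS.homology_exact₃ (i + 1) i rfl)
  · exact (ShortComplex.ShortExact.moduleCat_exact_iff_function_exact _).1
      (hS.homology_exact₁ (i + 1) i rfl)
  · have := hS.epi_g
    have : Epi (S.g.f 0) := inferInstance
    have := HomologicalComplex.epi_homologyMap_of_epi_of_not_rel S.g 0 (by simp)
    exact (ModuleCat.epi_iff_surjective _).1 this

lemma IsFiniteType.third (hS : S.ShortExact) (h₁ : IsFiniteType (chainHomology S.X₁))
    (h₂ : IsFiniteType (chainHomology S.X₂)) : IsFiniteType (chainHomology S.X₃) := by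
  obtain ⟨f, g, δ, hfg, hgδ, -, hg0⟩ := exists_longExact hS
  have := h₁.1
  have := h₂.1
  refine ⟨fun i => ?_, ?_⟩
  · cases i with
    | zero => exact Module.Finite.of_surjective _ hg0
    | succ i => exact moduleFinite_of_exact (hgδ i)
  · obtain ⟨a, ha⟩ := h₁.2
    obtain ⟨b, hb⟩ := h₂.2
    refine ⟨max a b + 1, fun i hi => ?_⟩
    obtain ⟨j, rfl⟩ : ∃ j, i = j + 1 := ⟨i - 1, by omega⟩
    have := ha j (by omega)
    have := hb (j + 1) (by omega)
    exact subsingleton_of_exact (hgδ j)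

lemma IsFiniteType.middle (hS : S.ShortExact) (h₁ : IsFiniteType (chainHomology S.X₁))
    (h₃ : IsFiniteType (chainHomology S.X₃)) : IsFiniteType (chainHomology S.X₂) := by
  obtain ⟨f, g, δ, hfg, hgδ, -, hg0⟩ := exists_longExact hS
  have := h₁.1
  have := h₃.1
  refine ⟨fun i => moduleFinite_of_exact (hfg i), ?_⟩
  obtain ⟨a, ha⟩ := h₁.2
  obtain ⟨c, hc⟩ := h₃.2
  refine ⟨max a c, fun i hi => ?_⟩
  have := ha i (by omega)
  have := hc i (by omega)
  exact subsingleton_of_exact (hfg i)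

lemma gradedEuler_shortExact (hS : S.ShortExact) (h₁ : IsFiniteType (chainHomology S.X₁))
    (h₂ : IsFiniteType (chainHomology S.X₂)) (h₃ : IsFiniteType (chainHomology S.X₃)) :
    gradedEuler (chainHomology S.X₂) =
      gradedEuler (chainHomology S.X₁) + gradedEuler (chainHomology S.X₃) := by
  obtain ⟨f, g, δ, hfg, hgδ, hδf, hg0⟩ := exists_longExact hS
  exact gradedEuler_of_longExact hfg hgδ hδf hg0 h₁ h₂ h₃

end ShortExact

end EulerCharacteristic

/-! ### Free simplicial chains -/

/-- The integral simplicial chains of a simplicial set, realised in degree `n` as the finitely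
supported integer-valued functions on the `n`-simplices. -/
noncomputable def SSet.freeChains : SSet.{0} ⥤ ChainComplex (ModuleCat.{0} ℤ) ℕ :=
  (SimplicialObject.whiskering _ _).obj (ModuleCat.free ℤ) ⋙
    AlgebraicTopology.alternatingFaceMapComplex _

/-- Maps out of `ℤ` in the category of abelian groups are elements. -/
noncomputable def coyonedaIntIso :
    coyoneda.obj (op (ModuleCat.of ℤ ℤ)) ≅ forget (ModuleCat.{0} ℤ) :=
  NatIso.ofComponents (fun M => Equiv.toIso
    { toFun := fun f => f.hom (1 : ℤ)
      invFun := fun x => ModuleCat.ofHom (LinearMap.toSpanSingleton ℤ M x)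
      left_inv := fun f => ModuleCat.hom_ext
        (LinearMap.ext_ring (LinearMap.toSpanSingleton_apply_one ℤ M _))
      right_inv := fun x => LinearMap.toSpanSingleton_apply_one ℤ M x })

/-- Coproducts of copies of `ℤ` are free abelian groups. -/
noncomputable def sigmaConstIntIso :
    sigmaConst.obj (ModuleCat.of ℤ ℤ) ≅ ModuleCat.free ℤ :=
  (sigmaConstAdj (ModuleCat.of ℤ ℤ)).leftAdjointUniq
    ((ModuleCat.adj ℤ).ofNatIsoRight coyonedaIntIso.symm)

/-- The free chains are the chains with integral coefficients. -/
noncomputable def SSet.chainComplexIsoFreeChains :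
    (SSet.chainComplexFunctor (ModuleCat.{0} ℤ)).obj (ModuleCat.of ℤ ℤ) ≅ SSet.freeChains :=
  Functor.isoWhiskerRight ((SimplicialObject.whiskering _ _).mapIso sigmaConstIntIso)
    (AlgebraicTopology.alternatingFaceMapComplex _)

namespace SSet

variable {X Y : SSet.{0}}

/-- A finitely supported function as a chain. -/
noncomputable def toChain (X : SSet.{0}) (n : ℕ) :
    (X _⦋n⦌ →₀ ℤ) →ₗ[ℤ] (freeChains.obj X).X n := LinearMap.id

/-- A chain as a finitely supported function. -/
noncomputable def ofChain (X : SSet.{0}) (n : ℕ) :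
    (freeChains.obj X).X n →ₗ[ℤ] (X _⦋n⦌ →₀ ℤ) := LinearMap.id

lemma freeChains_d_single (n : ℕ) (x : X _⦋n + 1⦌) :
    (freeChains.obj X).d (n + 1) n (toChain X (n + 1) (Finsupp.single x 1)) =
      toChain X n (∑ i : Fin (n + 2), (-1 : ℤ) ^ (i : ℕ) • Finsupp.single (X.δ i x) 1) := by
  have : (freeChains.obj X).d (n + 1) n = ∑ i : Fin (n + 2), (-1 : ℤ) ^ (i : ℕ) •
      (ModuleCat.free ℤ).map (X.δ i) :=
    AlgebraicTopology.AlternatingFaceMapComplex.obj_d_eq _ n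
  rw [this, map_sum]
  refine (LinearMap.congr_fun (ModuleCat.hom_sum (M := (ModuleCat.free ℤ).obj (X _⦋n + 1⦌))
    (N := (ModuleCat.free ℤ).obj (X _⦋n⦌)) _ _) _).trans ?_
  refine (LinearMap.sum_apply _ _ _).trans (Finset.sum_congr rfl fun i _ => ?_)
  have h : (ModuleCat.free ℤ).map (X.δ i) (toChain X (n + 1) (Finsupp.single x 1)) =
    toChain X n (Finsupp.single (X.δ i x) 1) := ModuleCat.free_map_apply _ _
  rw [map_zsmul, ← h]
  rfl

lemma freeChains_map_injective (f : X ⟶ Y) (n : ℕ)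
    (hf : Function.Injective (f.app (op ⦋n⦌))) :
    Function.Injective ((freeChains.map f).f n) :=
  Finsupp.mapDomain_injective hf

lemma mono_freeChains_map (f : X ⟶ Y) (hf : ∀ n : ℕ, Function.Injective (f.app (op ⦋n⦌))) :
    Mono (freeChains.map f) := by
  have (n : ℕ) : Mono ((freeChains.map f).f n) :=
    (ModuleCat.mono_iff_injective _).2 (freeChains_map_injective f n (hf n))
  exact HomologicalComplex.mono_of_mono_f _ this

end SSet

lemma mapDomain_mem_range_of_inter {P A B S : Type*} {p : P → A} {i : A → S} {j : B → S}
    (hi : Function.Injective i) (hp : Function.Injective p)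
    (hinter : ∀ a b, i a = j b → ∃ c, p c = a) (x : A →₀ ℤ) (y : B →₀ ℤ)
    (h : y.mapDomain j = x.mapDomain i) : ∃ c : P →₀ ℤ, c.mapDomain p = x := by
  refine (Finsupp.mem_range_mapDomain_iff p hp x).2 fun a ha => ?_
  have h1 : x.mapDomain i (i a) = x a := Finsupp.mapDomain_apply hi _ _
  rw [← h1, ← h]
  refine Finsupp.mapDomain_of_notMem_range _ _ ?_
  rintro ⟨b, hb⟩
  exact ha (hinter a b hb.symm)

lemma exists_mapDomain_add_mapDomain {A B S : Type*} {i : A → S} {j : B → S}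
    (hcover : ∀ s, (∃ a, i a = s) ∨ ∃ b, j b = s) (s : S →₀ ℤ) :
    ∃ (x : A →₀ ℤ) (y : B →₀ ℤ), s = x.mapDomain i + y.mapDomain j := by
  induction s using Finsupp.induction_linear with
  | zero => exact ⟨0, 0, by simp⟩
  | add f g hf hg =>
    obtain ⟨x, y, rfl⟩ := hf
    obtain ⟨x', y', rfl⟩ := hg
    exact ⟨x + x', y + y', by simp only [Finsupp.mapDomain_add]; abel⟩
  | single s m =>
    rcases hcover s with ⟨a, rfl⟩ | ⟨b, rfl⟩
    · exact ⟨Finsupp.single a m, 0, by simp⟩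
    · exact ⟨0, Finsupp.single b m, by simp⟩

lemma shortExact_cokernel {A B : ChainComplex (ModuleCat.{0} ℤ) ℕ} (f : A ⟶ B) [Mono f] :
    (ShortComplex.mk f (cokernel.π f) (cokernel.condition f)).ShortExact where
  exact := ShortComplex.exact_cokernel f

lemma cokernel_π_f_surjective {A B : ChainComplex (ModuleCat.{0} ℤ) ℕ} (f : A ⟶ B) (n : ℕ) :
    Function.Surjective ((cokernel.π f).f n) :=
  (ModuleCat.epi_iff_surjective _).1 inferInstance

lemma cokernel_π_f_eq_zero_iff {A B : ChainComplex (ModuleCat.{0} ℤ) ℕ} (f : A ⟶ B) [Mono f]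
    (n : ℕ) (x : B.X n) : (cokernel.π f).f n x = 0 ↔ ∃ a, f.f n a = x := by
  have h := (shortExact_cokernel f).map_of_exact (HomologicalComplex.eval (ModuleCat.{0} ℤ) _ n)
  have h2 := (ShortComplex.ShortExact.moduleCat_exact_iff_function_exact _).1 h.exact
  exact h2 x

namespace SSet

variable {P A B S : SSet.{0}} (p : P ⟶ A) (q : P ⟶ B) (i : A ⟶ S) (j : B ⟶ S)

lemma exists_freeChains_map_add {A B S : SSet.{0}} (i : A ⟶ S) (j : B ⟶ S) (n : ℕ)
    (hcover : ∀ s : S _⦋n⦌, (∃ a, i.app _ a = s) ∨ ∃ b, j.app _ b = s)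
    (s : (freeChains.obj S).X n) :
    ∃ a b, s = (freeChains.map i).f n a + (freeChains.map j).f n b := by
  obtain ⟨a, b, hab⟩ := exists_mapDomain_add_mapDomain hcover (ofChain S n s)
  exact ⟨toChain A n a, toChain B n b, hab⟩

/-- If `S` is the union of two simplicial subsets `A` and `B` with intersection `P`, then the
complex of chains of `S` modulo chains of `B` is the complex of chains of `A` modulo chains of
`P`. -/
lemma shortExact_of_union (comm : p ≫ i = q ≫ j)
    (hi : ∀ n : ℕ, Function.Injective (i.app (op ⦋n⦌)))
    (hj : ∀ n : ℕ, Function.Injective (j.app (op ⦋n⦌)))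
    (hp : ∀ n : ℕ, Function.Injective (p.app (op ⦋n⦌)))
    (hcover : ∀ (n : ℕ) (s : S _⦋n⦌), (∃ a, i.app _ a = s) ∨ ∃ b, j.app _ b = s)
    (hinter : ∀ (n : ℕ) (a : A _⦋n⦌) (b : B _⦋n⦌), i.app _ a = j.app _ b → ∃ c, p.app _ c = a) :
    (ShortComplex.mk (freeChains.map p) (freeChains.map i ≫ cokernel.π (freeChains.map j))
      (by rw [← Category.assoc, ← Functor.map_comp, comm, Functor.map_comp, Category.assoc,
        cokernel.condition, comp_zero])).ShortExact := by
  have := mono_freeChains_map j hj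
  refine HomologicalComplex.shortExact_of_degreewise_shortExact _ fun n => ?_
  refine ModuleCat.shortComplex_shortExact _ ?_ (freeChains_map_injective p n (hp n)) ?_
  · intro x
    have hx : (freeChains.map i ≫ cokernel.π (freeChains.map j)).f n x = 0 ↔
        ∃ b, (freeChains.map j).f n b = (freeChains.map i).f n x :=
      cokernel_π_f_eq_zero_iff (freeChains.map j) n _
    refine hx.trans ⟨?_, ?_⟩
    · rintro ⟨b, hb⟩
      exact mapDomain_mem_range_of_inter (hi n) (hp n) (hinter n) (ofChain A n x) (ofChain B n b) hb
    · rintro ⟨c, rfl⟩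
      refine ⟨(freeChains.map q).f n c, ?_⟩
      have := congrArg (fun f => (freeChains.map f).f n c) comm
      simp only [Functor.map_comp] at this
      exact this.symm
  · intro y
    obtain ⟨s, hs⟩ := cokernel_π_f_surjective (freeChains.map j) n y
    obtain ⟨a, b, hab⟩ := exists_freeChains_map_add i j n (hcover n) s
    have hb := (cokernel_π_f_eq_zero_iff (freeChains.map j) n _).2 ⟨b, rfl⟩
    refine ⟨a, ?_⟩
    have : (cokernel.π (freeChains.map j)).f n ((freeChains.map i).f n a) = y := by
      rw [← hs, hab, map_add, hb, add_zero]
    exact this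

end SSet

end

/-! ### Barycentric subdivision of ordered simplices -/

namespace OrderedChain

variable {D E : Type*}

/-- The free abelian group on the `n`-tuples of points of `D`. A tuple of length `n` is thought of
as a simplex of dimension `n - 1`, so that this is the augmented complex of ordered simplices. -/
abbrev Chain (D : Type*) (n : ℕ) : Type _ := (Fin n → D) →₀ ℤ

/-- The boundary in the augmented complex of ordered simplices. -/
noncomputable def bd (n : ℕ) : Chain D (n + 1) →ₗ[ℤ] Chain D n :=
  Finsupp.linearCombination ℤ fun v =>
    ∑ i : Fin (n + 1), (-1 : ℤ) ^ (i : ℕ) • Finsupp.single (v ∘ i.succAbove) 1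

/-- The join with a point `b`, put in front. -/
noncomputable def cone (b : D) (n : ℕ) : Chain D n →ₗ[ℤ] Chain D (n + 1) :=
  Finsupp.lmapDomain ℤ ℤ (Fin.cons (α := fun _ => D) b)

/-- The map on chains induced by a map of points. -/
noncomputable def push (f : D → E) (n : ℕ) : Chain D n →ₗ[ℤ] Chain E n :=
  Finsupp.lmapDomain ℤ ℤ fun v => f ∘ v

lemma bd_single (n : ℕ) (v : Fin (n + 1) → D) : bd n (Finsupp.single v 1) =
    ∑ i : Fin (n + 1), (-1 : ℤ) ^ (i : ℕ) • Finsupp.single (v ∘ i.succAbove) 1 := by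
  simp [bd]

lemma cone_single (b : D) (n : ℕ) (v : Fin n → D) :
    cone b n (Finsupp.single v 1) = Finsupp.single (Fin.cons b v : Fin (n + 1) → D) 1 := by
  simp [cone]

lemma push_single (f : D → E) (n : ℕ) (v : Fin n → D) :
    push f n (Finsupp.single v 1) = Finsupp.single (f ∘ v) 1 := by
  simp [push]

lemma chain_hom_ext {n : ℕ} {M : Type*} [AddCommGroup M] {f g : Chain D n →ₗ[ℤ] M}
    (h : ∀ v, f (Finsupp.single v 1) = g (Finsupp.single v 1)) : f = g :=
  Finsupp.lhom_ext' fun v => LinearMap.ext_ring (h v)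

lemma bd_cone_zero (b : D) (c : Chain D 0) : bd 0 (cone b 0 c) = c := by
  suffices bd 0 ∘ₗ cone b 0 = LinearMap.id from LinearMap.congr_fun this c
  refine chain_hom_ext fun v => ?_
  rw [LinearMap.comp_apply, cone_single, bd_single]
  simp [Subsingleton.elim _ v]

lemma bd_cone_succ (b : D) (n : ℕ) (c : Chain D (n + 1)) :
    bd (n + 1) (cone b (n + 1) c) = c - cone b n (bd n c) := by
  suffices bd (n + 1) ∘ₗ cone b (n + 1) = LinearMap.id - cone b n ∘ₗ bd n from
    LinearMap.congr_fun this c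
  refine chain_hom_ext fun v => ?_
  rw [LinearMap.comp_apply, cone_single, bd_single, Fin.sum_univ_succ, LinearMap.sub_apply,
    LinearMap.comp_apply, bd_single, map_sum, sub_eq_add_neg, ← Finset.sum_neg_distrib]
  congr 1
  · simp only [Fin.val_zero, pow_zero, one_smul, LinearMap.id_apply]
    congr 1
  · refine Finset.sum_congr rfl fun i _ => ?_
    have : (Fin.cons b v : Fin (n + 2) → D) ∘ i.succ.succAbove = Fin.cons b (v ∘ i.succAbove) := by
      funext j
      refine Fin.cases ?_ (fun j => ?_) j <;> simp
    rw [this, map_zsmul, cone_single, Fin.val_succ, pow_succ, mul_neg_one, neg_smul]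

lemma bd_bd (n : ℕ) (c : Chain D (n + 2)) : bd n (bd (n + 1) c) = 0 := by
  suffices h : ∀ n, bd (D := D) n ∘ₗ bd (n + 1) = 0 from LinearMap.congr_fun (h n) c
  clear c n
  intro n
  induction n with
  | zero =>
    refine chain_hom_ext fun v => ?_
    rw [← Fin.cons_self_tail v, ← cone_single, LinearMap.comp_apply, bd_cone_succ, map_sub,
      bd_cone_zero, sub_self, LinearMap.zero_apply]
  | succ n ih =>
    refine chain_hom_ext fun v => ?_
    rw [← Fin.cons_self_tail v, ← cone_single, LinearMap.comp_apply, bd_cone_succ, map_sub,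
      bd_cone_succ, ← LinearMap.comp_apply (bd n), ih, LinearMap.zero_apply, map_zero, sub_zero,
      sub_self, LinearMap.zero_apply]

lemma push_bd (f : D → E) (n : ℕ) (c : Chain D (n + 1)) :
    push f n (bd n c) = bd n (push f (n + 1) c) := by
  suffices push f n ∘ₗ bd n = bd n ∘ₗ push f (n + 1) from LinearMap.congr_fun this c
  refine chain_hom_ext fun v => ?_
  rw [LinearMap.comp_apply, LinearMap.comp_apply, bd_single, push_single, bd_single, map_sum]
  refine Finset.sum_congr rfl fun i _ => ?_
  rw [map_zsmul, push_single]
  rfl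

lemma push_cone (f : D → E) (b : D) (n : ℕ) (c : Chain D n) :
    push f (n + 1) (cone b n c) = cone (f b) n (push f n c) := by
  suffices push f (n + 1) ∘ₗ cone b n = cone (f b) n ∘ₗ push f n from LinearMap.congr_fun this c
  refine chain_hom_ext fun v => ?_
  rw [LinearMap.comp_apply, LinearMap.comp_apply, cone_single, push_single, push_single,
    cone_single]
  congr 1
  funext j
  refine Fin.cases ?_ (fun j => ?_) j <;> simp

section Subdivision

variable (b : ∀ n, (Fin (n + 1) → D) → D) (b' : ∀ n, (Fin (n + 1) → E) → E)

/-- The subdivision operator which cones off the subdivided boundary of a simplex `v` from the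
apex `b n v`. -/
noncomputable def sd : ∀ n, Chain D n →ₗ[ℤ] Chain D n
  | 0 => LinearMap.id
  | n + 1 => Finsupp.linearCombination ℤ fun v =>
      cone (b n v) n (sd n (bd n (Finsupp.single v 1)))

/-- The chain homotopy between the identity and the subdivision operator. -/
noncomputable def sdHomotopy : ∀ n, Chain D n →ₗ[ℤ] Chain D (n + 1)
  | 0 => 0
  | n + 1 => Finsupp.linearCombination ℤ fun v =>
      cone (b n v) (n + 1)
        (Finsupp.single v 1 - sdHomotopy n (bd n (Finsupp.single v 1)))

lemma sd_single (n : ℕ) (v : Fin (n + 1) → D) : sd b (n + 1) (Finsupp.single v 1) =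
    cone (b n v) n (sd b n (bd n (Finsupp.single v 1))) := by
  simp [sd]

lemma sdHomotopy_single (n : ℕ) (v : Fin (n + 1) → D) :
    sdHomotopy b (n + 1) (Finsupp.single v 1) = cone (b n v) (n + 1)
      (Finsupp.single v 1 - sdHomotopy b n (bd n (Finsupp.single v 1))) := by
  simp [sdHomotopy]

lemma bd_sd (n : ℕ) (c : Chain D (n + 1)) : bd n (sd b (n + 1) c) = sd b n (bd n c) := by
  suffices h : ∀ n, bd n ∘ₗ sd b (n + 1) = sd b n ∘ₗ bd n from LinearMap.congr_fun (h n) c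
  clear c n
  intro n
  induction n with
  | zero =>
    refine chain_hom_ext fun v => ?_
    rw [LinearMap.comp_apply, sd_single, bd_cone_zero, LinearMap.comp_apply]
  | succ n ih =>
    refine chain_hom_ext fun v => ?_
    rw [LinearMap.comp_apply, sd_single, bd_cone_succ, ← LinearMap.comp_apply (bd n), ih,
      LinearMap.comp_apply, bd_bd, map_zero, map_zero, sub_zero, LinearMap.comp_apply]

lemma bd_sdHomotopy (n : ℕ) (c : Chain D (n + 1)) :
    bd (n + 1) (sdHomotopy b (n + 1) c) + sdHomotopy b n (bd n c) = c - sd b (n + 1) c := by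
  suffices h : ∀ n, bd (n + 1) ∘ₗ sdHomotopy b (n + 1) + sdHomotopy b n ∘ₗ bd n =
      LinearMap.id - sd b (n + 1) from LinearMap.congr_fun (h n) c
  clear c n
  intro n
  induction n with
  | zero =>
    refine chain_hom_ext fun v => ?_
    rw [LinearMap.add_apply, LinearMap.comp_apply, LinearMap.comp_apply, LinearMap.sub_apply,
      sdHomotopy_single, bd_cone_succ, sd_single]
    simp [sdHomotopy, sd]
  | succ n ih =>
    refine chain_hom_ext fun v => ?_
    have h := LinearMap.congr_fun ih (bd (n + 1) (Finsupp.single v 1))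
    rw [LinearMap.add_apply, LinearMap.comp_apply, LinearMap.comp_apply, LinearMap.sub_apply,
      bd_bd, map_zero, add_zero, LinearMap.id_apply] at h
    rw [LinearMap.add_apply, LinearMap.comp_apply, LinearMap.comp_apply, LinearMap.sub_apply,
      sdHomotopy_single, bd_cone_succ, sd_single, map_sub, h, LinearMap.id_apply, sub_sub_cancel]
    abel

variable {b b'}

lemma push_sd {f : D → E} (hf : ∀ n v, f (b n v) = b' n (f ∘ v)) (n : ℕ) (c : Chain D n) :
    push f n (sd b n c) = sd b' n (push f n c) := by
  suffices h : ∀ n, push f n ∘ₗ sd b n = sd b' n ∘ₗ push f n from LinearMap.congr_fun (h n) c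
  clear c n
  intro n
  induction n with
  | zero => simp [sd]
  | succ n ih =>
    refine chain_hom_ext fun v => ?_
    rw [LinearMap.comp_apply, sd_single, push_cone, ← LinearMap.comp_apply (push f n), ih,
      LinearMap.comp_apply, LinearMap.comp_apply, push_single, sd_single, push_bd, push_single, hf]

lemma push_sdHomotopy {f : D → E} (hf : ∀ n v, f (b n v) = b' n (f ∘ v)) (n : ℕ)
    (c : Chain D n) : push f (n + 1) (sdHomotopy b n c) = sdHomotopy b' n (push f n c) := by
  suffices h : ∀ n, push f (n + 1) ∘ₗ sdHomotopy b n = sdHomotopy b' n ∘ₗ push f n from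
    LinearMap.congr_fun (h n) c
  clear c n
  intro n
  induction n with
  | zero => simp [sdHomotopy]
  | succ n ih =>
    refine chain_hom_ext fun v => ?_
    rw [LinearMap.comp_apply, sdHomotopy_single, push_cone, map_sub,
      ← LinearMap.comp_apply (push f (n + 1)) (sdHomotopy b n), ih,
      LinearMap.comp_apply, LinearMap.comp_apply, push_single, sdHomotopy_single, push_bd,
      push_single, hf]

end Subdivision

section Mesh

variable [PseudoMetricSpace D]

/-- `Finer v r w` says that `w` is contained in every closed ball which contains `v`, and that
its points are at distance at most `r` from each other. -/
def Finer {n m : ℕ} (v : Fin n → D) (r : ℝ) (w : Fin m → D) : Prop :=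
  (∀ x s, (∀ i, dist x (v i) ≤ s) → ∀ i, dist x (w i) ≤ s) ∧ ∀ i j, dist (w i) (w j) ≤ r

/-- If the apex of each `n`-simplex of mesh `d` is at distance at most `n / (n + 1) * d` from the
vertices, then the subdivision of an `n`-simplex of mesh `d` has mesh at most
`n / (n + 1) * d`. -/
lemma sd_finer {b : ∀ n, (Fin (n + 1) → D) → D}
    (hball : ∀ n v x s, (∀ i, dist x (v i) ≤ s) → dist x (b n v) ≤ s)
    (hmesh : ∀ (n : ℕ) v d, (∀ i j, dist (v i) (v j) ≤ d) → ∀ i,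
      dist (b n v) (v i) ≤ n / (n + 1) * d)
    (n : ℕ) (v : Fin (n + 1) → D) (d : ℝ) (hd : ∀ i j, dist (v i) (v j) ≤ d) :
    sd b (n + 1) (Finsupp.single v 1) ∈
      Finsupp.supported ℤ ℤ {w | Finer v (n / (n + 1) * d) w} := by
  induction n generalizing d with
  | zero =>
    rw [sd_single, bd_single, map_sum, map_sum]
    refine Submodule.sum_mem _ fun i _ => ?_
    rw [map_zsmul, map_zsmul]
    refine Submodule.smul_mem _ _ ?_
    rw [sd, LinearMap.id_apply, cone_single]
    refine Finsupp.single_mem_supported _ _ ⟨fun x s hs i => ?_, fun i j => ?_⟩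
    · rw [Fin.fin_one_eq_zero i]
      exact hball 0 v x s hs
    · rw [Fin.fin_one_eq_zero i, Fin.fin_one_eq_zero j]
      simp
  | succ n ih =>
    have hd0 : 0 ≤ d := dist_nonneg.trans (hd 0 0)
    rw [sd_single, bd_single, map_sum, map_sum]
    refine Submodule.sum_mem _ fun i _ => ?_
    rw [map_zsmul, map_zsmul]
    refine Submodule.smul_mem _ _ ?_
    have h1 := ih (v ∘ i.succAbove) d fun j k => hd _ _
    have h2 : cone (b (n + 1) v) (n + 1) (sd b (n + 1) (Finsupp.single (v ∘ i.succAbove) 1)) ∈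
        (Finsupp.supported ℤ ℤ {w | Finer (v ∘ i.succAbove) (n / (n + 1) * d) w}).map
          (cone (b (n + 1) v) (n + 1)) := Submodule.mem_map_of_mem h1
    rw [cone, Finsupp.lmapDomain_supported] at h2
    refine Finsupp.supported_mono ?_ h2
    rintro _ ⟨w, ⟨hw1, hw2⟩, rfl⟩
    have hle : (n : ℝ) / (n + 1) * d ≤ ((n + 1 : ℕ) : ℝ) / ((n + 1 : ℕ) + 1) * d := by
      refine mul_le_mul_of_nonneg_right ?_ hd0
      rw [div_le_div_iff₀ (by positivity) (by positivity)]
      push_cast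
      nlinarith
    have hb : ∀ j, dist (b (n + 1) v) (w j) ≤ ((n + 1 : ℕ) : ℝ) / ((n + 1 : ℕ) + 1) * d :=
      hw1 _ _ fun j => hmesh (n + 1) v d hd _
    refine ⟨fun x s hs j => ?_, fun j k => ?_⟩
    · refine Fin.cases ?_ (fun j => ?_) j
      · exact hball _ v x s hs
      · exact hw1 x s (fun k => hs _) j
    · refine Fin.cases ?_ (fun j => ?_) j <;> refine Fin.cases ?_ (fun k => ?_) k
      · simp only [Fin.cons_zero, dist_self]
        positivity
      · exact hb k
      · rw [dist_comm]
        exact hb j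
      · exact (hw2 j k).trans hle

lemma iterate_sd_finer {b : ∀ n, (Fin (n + 1) → D) → D}
    (hball : ∀ n v x s, (∀ i, dist x (v i) ≤ s) → dist x (b n v) ≤ s)
    (hmesh : ∀ (n : ℕ) v d, (∀ i j, dist (v i) (v j) ≤ d) → ∀ i,
      dist (b n v) (v i) ≤ n / (n + 1) * d)
    (n : ℕ) (v : Fin (n + 1) → D) (d : ℝ) (hd : ∀ i j, dist (v i) (v j) ≤ d) (N : ℕ) :
    (sd b (n + 1))^[N] (Finsupp.single v 1) ∈
      Finsupp.supported ℤ ℤ {w | Finer v ((n / (n + 1) : ℝ) ^ N * d) w} := by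
  induction N with
  | zero =>
    exact Finsupp.single_mem_supported _ _ ⟨fun x s hs => hs, by simpa using hd⟩
  | succ N ih =>
    rw [Function.iterate_succ_apply', Finsupp.supported_eq_span_single] at *
    refine Submodule.span_induction (p := fun c _ => sd b (n + 1) c ∈ _) ?_ ?_ ?_ ?_ ih
    · rintro _ ⟨w, hw, rfl⟩
      have h := sd_finer hball hmesh n w _ hw.2
      rw [← Finsupp.supported_eq_span_single]
      refine Finsupp.supported_mono ?_ h
      rintro u ⟨hu1, hu2⟩
      refine ⟨fun x s hs => hu1 x s (hw.1 x s hs), fun i j => (hu2 i j).trans_eq ?_⟩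
      ring
    · simp
    · intro x y _ _ hx hy
      rw [map_add]
      exact Submodule.add_mem _ hx hy
    · intro a x _ hx
      rw [map_zsmul]
      exact Submodule.smul_mem _ _ hx

end Mesh

end OrderedChain

/-! ### Convex combinations in standard simplices -/

namespace stdSimplex

variable {X Y Z : Type*} [Fintype X] [Fintype Y] [Fintype Z]

/-- The convex combination of a family `v` of points of a standard simplex with weights `p`. As a
function of `p`, it is the affine map between standard simplices which takes the vertices to the
points `v x`. -/
noncomputable def comb (v : X → stdSimplex ℝ Y) (p : stdSimplex ℝ X) : stdSimplex ℝ Y :=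
  ⟨fun y => ∑ x, p x * v x y, fun y => Finset.sum_nonneg fun x _ => mul_nonneg (p.2.1 x)
    ((v x).2.1 y), by
    rw [Finset.sum_comm]
    simp_rw [← Finset.mul_sum, sum_eq_one, mul_one]
    exact p.2.2⟩

lemma comb_apply (v : X → stdSimplex ℝ Y) (p : stdSimplex ℝ X) (y : Y) :
    comb v p y = ∑ x, p x * v x y := rfl

lemma continuous_comb (v : X → stdSimplex ℝ Y) : Continuous (comb v) := by
  refine Continuous.subtype_mk (continuous_pi fun y => ?_) _
  refine continuous_finsetSum _ fun x _ => ?_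
  exact ((continuous_apply x).comp continuous_subtype_val).mul continuous_const

lemma comb_comb (v : Y → stdSimplex ℝ Z) (u : X → stdSimplex ℝ Y) (p : stdSimplex ℝ X) :
    comb v (comb u p) = comb (fun x => comb v (u x)) p := by
  ext z
  simp only [comb_apply, Finset.sum_mul, Finset.mul_sum, mul_assoc]
  rw [Finset.sum_comm]

lemma comb_vertex [DecidableEq X] (p : stdSimplex ℝ X) : comb vertex p = p := by
  ext x
  simp [comb_apply, Pi.single_apply]

lemma comb_vertex_comp [DecidableEq Y] (f : X → Y) (p : stdSimplex ℝ X) :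
    comb (fun x => vertex (f x)) p = map f p := by
  ext y
  simp [comb_apply, FunOnFinite.linearMap_apply_apply, Pi.single_apply, Finset.sum_filter,
    eq_comm]

lemma comb_map (v : Y → stdSimplex ℝ Z) (f : X → Y) (p : stdSimplex ℝ X) :
    comb v (map f p) = comb (v ∘ f) p := by
  classical
  rw [← comb_vertex_comp, comb_comb]
  congr 1
  funext x
  ext z
  simp [comb_apply, Pi.single_apply]

lemma dist_comb_le (v : X → stdSimplex ℝ Y) (p : stdSimplex ℝ X) (x : stdSimplex ℝ Y) (s : ℝ)
    (h : ∀ i, dist x (v i) ≤ s) : dist x (comb v p) ≤ s := by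
  have hs : 0 ≤ s := by
    by_contra hs
    have : ∑ i, p i = 0 := Finset.sum_eq_zero fun i _ => (hs (dist_nonneg.trans (h i))).elim
    rw [sum_eq_one] at this
    exact one_ne_zero this
  rw [Subtype.dist_eq, dist_pi_le_iff hs]
  intro y
  rw [Real.dist_eq]
  have h1 : (x.1 y - (comb v p).1 y) = ∑ i, p i * (x y - v i y) := by
    simp_rw [mul_sub, Finset.sum_sub_distrib, ← Finset.sum_mul, sum_eq_one, one_mul]
    rfl
  rw [h1]
  calc |∑ i, p i * (x y - v i y)| ≤ ∑ i, p i * s := by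
        refine (Finset.abs_sum_le_sum_abs _ _).trans (Finset.sum_le_sum fun i _ => ?_)
        rw [abs_mul, abs_of_nonneg (zero_le p i)]
        refine mul_le_mul_of_nonneg_left ?_ (zero_le p i)
        have := (dist_pi_le_iff hs).1 (h i) y
        rwa [Real.dist_eq] at this
    _ = s := by rw [← Finset.sum_mul, sum_eq_one, one_mul]

/-- The barycenter of a family of points of a standard simplex. -/
noncomputable def bary (n : ℕ) (v : Fin (n + 1) → stdSimplex ℝ Y) : stdSimplex ℝ Y :=
  comb v barycenter

lemma comb_bary (w : Y → stdSimplex ℝ Z) (n : ℕ) (v : Fin (n + 1) → stdSimplex ℝ Y) :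
    comb w (bary n v) = bary n (comb w ∘ v) :=
  comb_comb _ _ _

lemma dist_bary_le (n : ℕ) (v : Fin (n + 1) → stdSimplex ℝ Y) (d : ℝ)
    (hd : ∀ i j, dist (v i) (v j) ≤ d) (i : Fin (n + 1)) :
    dist (bary n v) (v i) ≤ n / (n + 1) * d := by
  have hd0 : 0 ≤ d := dist_nonneg.trans (hd 0 0)
  rw [Subtype.dist_eq, dist_pi_le_iff (by positivity)]
  intro y
  rw [Real.dist_eq]
  have h1 : (bary n v).1 y - (v i).1 y = ∑ j, (1 / (n + 1) : ℝ) * (v j y - v i y) := by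
    rw [← Finset.mul_sum, Finset.sum_sub_distrib, mul_sub]
    simp only [Finset.sum_const, Finset.card_univ, Fintype.card_fin, nsmul_eq_mul]
    have : (bary n v).1 y = (1 / (n + 1) : ℝ) * ∑ j, v j y := by
      rw [Finset.mul_sum]
      refine (comb_apply _ _ _).trans (Finset.sum_congr rfl fun j _ => ?_)
      have hb : (barycenter : stdSimplex ℝ (Fin (n + 1))) j = 1 / (n + 1) :=
        (barycenter_apply j).trans (by simp)
      rw [hb]
    rw [this]
    push_cast
    field_simp
    rfl
  rw [h1]
  calc |∑ j, (1 / (n + 1) : ℝ) * (v j y - v i y)|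
      ≤ ∑ j, (if j = i then 0 else (1 / (n + 1) : ℝ) * d) := by
        refine (Finset.abs_sum_le_sum_abs _ _).trans (Finset.sum_le_sum fun j _ => ?_)
        split_ifs with hj
        · simp [hj]
        · rw [abs_mul, abs_of_nonneg (by positivity)]
          refine mul_le_mul_of_nonneg_left ?_ (by positivity)
          have := (dist_pi_le_iff hd0).1 (hd j i) y
          rwa [Real.dist_eq] at this
    _ = n / (n + 1) * d := by
        rw [← Finset.sum_erase_add _ _ (Finset.mem_univ i), Finset.sum_congr rfl
          (g := fun _ => (1 / (n + 1) : ℝ) * d) (fun j hj => if_neg (Finset.ne_of_mem_erase hj))]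
        simp
        ring

end stdSimplex

/-! ### Subdivision of singular chains -/

namespace SingularChain

open OrderedChain stdSimplex

/-- The affine map between standard simplices with given values at the vertices. -/
noncomputable def affine {Y Z : Type*} [Fintype Y] [Fintype Z] (v : Y → stdSimplex ℝ Z) :
    C(stdSimplex ℝ Y, stdSimplex ℝ Z) :=
  ⟨comb v, continuous_comb v⟩

lemma affine_comp_affine {W Y Z : Type*} [Fintype W] [Fintype Y] [Fintype Z]
    (v : Y → stdSimplex ℝ Z) (u : W → stdSimplex ℝ Y) :
    (affine v).comp (affine u) = affine (affine v ∘ u) :=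
  ContinuousMap.ext fun p => comb_comb v u p

lemma affine_vertex (Y : Type*) [Fintype Y] [DecidableEq Y] :
    affine (vertex (S := ℝ) (X := Y)) = ContinuousMap.id _ :=
  ContinuousMap.ext fun p => comb_vertex p

lemma affine_comp_vertex {Y Z : Type*} [Fintype Y] [Fintype Z] [DecidableEq Y]
    (v : Y → stdSimplex ℝ Z) : affine v ∘ vertex = v := by
  funext x
  ext z
  simp [affine, comb_apply, Pi.single_apply]

/-- The map of standard simplices induced by a map of the sets of vertices. -/
noncomputable def vertexMap {W Y : Type*} [Fintype W] [Fintype Y] (f : W → Y) :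
    C(stdSimplex ℝ W, stdSimplex ℝ Y) :=
  ⟨stdSimplex.map f, continuous_map f⟩

lemma affine_comp_vertexMap {W Y Z : Type*} [Fintype W] [Fintype Y] [Fintype Z]
    (v : Y → stdSimplex ℝ Z) (f : W → Y) :
    (affine v).comp (vertexMap f) = affine (v ∘ f) :=
  ContinuousMap.ext fun p => comb_map v f p

variable {X : Type*} [TopologicalSpace X] {Y Z : Type*} [Fintype Y] [Fintype Z]

/-- Singular chains with integral coefficients. -/
abbrev SChain (X : Type*) [TopologicalSpace X] (n : ℕ) : Type _ :=
  C(stdSimplex ℝ (Fin (n + 1)), X) →₀ ℤ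

/-- The boundary of singular chains. -/
noncomputable def sbd (n : ℕ) : SChain X (n + 1) →ₗ[ℤ] SChain X n :=
  Finsupp.linearCombination ℤ fun s =>
    ∑ i : Fin (n + 2), (-1 : ℤ) ^ (i : ℕ) • Finsupp.single (s.comp (vertexMap i.succAbove)) 1

lemma sbd_single (n : ℕ) (s : C(stdSimplex ℝ (Fin (n + 1 + 1)), X)) :
    sbd n (Finsupp.single s 1) = ∑ i : Fin (n + 2), (-1 : ℤ) ^ (i : ℕ) •
      Finsupp.single (s.comp (vertexMap i.succAbove)) 1 := by
  simp [sbd]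

/-- The singular chain obtained by composing a map `s` out of a standard simplex with the affine
simplices of a chain of ordered simplices. -/
noncomputable def realize (s : C(stdSimplex ℝ Y, X)) (n : ℕ) :
    Chain (stdSimplex ℝ Y) (n + 1) →ₗ[ℤ] SChain X n :=
  Finsupp.lmapDomain ℤ ℤ fun v => s.comp (affine v)

lemma realize_single (s : C(stdSimplex ℝ Y, X)) (n : ℕ) (v : Fin (n + 1) → stdSimplex ℝ Y) :
    realize s n (Finsupp.single v 1) = Finsupp.single (s.comp (affine v)) 1 := by
  simp [realize]

lemma sbd_realize (s : C(stdSimplex ℝ Y, X)) (n : ℕ) (c : Chain (stdSimplex ℝ Y) (n + 2)) :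
    sbd n (realize s (n + 1) c) = realize s n (bd (n + 1) c) := by
  suffices sbd n ∘ₗ realize s (n + 1) = realize s n ∘ₗ bd (n + 1) from LinearMap.congr_fun this c
  refine chain_hom_ext fun v => ?_
  rw [LinearMap.comp_apply, realize_single, LinearMap.comp_apply, bd_single, sbd_single, map_sum]
  refine Finset.sum_congr rfl fun i _ => ?_
  rw [map_zsmul, realize_single, ContinuousMap.comp_assoc, affine_comp_vertexMap]

lemma realize_comp_affine (s : C(stdSimplex ℝ Z, X)) (v : Y → stdSimplex ℝ Z) (n : ℕ)
    (c : Chain (stdSimplex ℝ Y) (n + 1)) :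
    realize (s.comp (affine v)) n c = realize s n (push (affine v) (n + 1) c) := by
  suffices realize (s.comp (affine v)) n = realize s n ∘ₗ push (affine v) (n + 1) from
    LinearMap.congr_fun this c
  refine chain_hom_ext fun u => ?_
  rw [realize_single, LinearMap.comp_apply, push_single, realize_single, ContinuousMap.comp_assoc,
    affine_comp_affine]

/-- The tautological simplex of a standard simplex. -/
noncomputable def taut (n : ℕ) : Chain (stdSimplex ℝ (Fin (n + 1))) (n + 1) :=
  Finsupp.single vertex 1

lemma push_affine_taut {n : ℕ} (v : Fin (n + 1) → stdSimplex ℝ Y) :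
    push (affine v) (n + 1) (taut n) = Finsupp.single v 1 := by
  rw [taut, push_single, affine_comp_vertex]

lemma realize_taut {n : ℕ} (s : C(stdSimplex ℝ (Fin (n + 1)), X)) :
    realize s n (taut n) = Finsupp.single s 1 := by
  rw [taut, realize_single, affine_vertex, ContinuousMap.comp_id]

lemma schain_hom_ext {n : ℕ} {M : Type*} [AddCommGroup M] {f g : SChain X n →ₗ[ℤ] M}
    (h : ∀ s, f (Finsupp.single s 1) = g (Finsupp.single s 1)) : f = g :=
  Finsupp.lhom_ext' fun v => LinearMap.ext_ring (h v)

/-- The barycentric subdivision of singular chains. -/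
noncomputable def ssd (n : ℕ) : SChain X n →ₗ[ℤ] SChain X n :=
  Finsupp.linearCombination ℤ fun s => realize s n (sd bary (n + 1) (taut n))

/-- The chain homotopy between the identity and the subdivision of singular chains. -/
noncomputable def ssdHomotopy (n : ℕ) : SChain X n →ₗ[ℤ] SChain X (n + 1) :=
  Finsupp.linearCombination ℤ fun s => realize s (n + 1) (sdHomotopy bary (n + 1) (taut n))

lemma ssd_single (n : ℕ) (s : C(stdSimplex ℝ (Fin (n + 1)), X)) :
    ssd n (Finsupp.single s 1) = realize s n (sd bary (n + 1) (taut n)) := by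
  simp [ssd]

lemma ssdHomotopy_single (n : ℕ) (s : C(stdSimplex ℝ (Fin (n + 1)), X)) :
    ssdHomotopy n (Finsupp.single s 1) =
      realize s (n + 1) (sdHomotopy bary (n + 1) (taut n)) := by
  simp [ssdHomotopy]

lemma ssd_realize (s : C(stdSimplex ℝ Y, X)) (n : ℕ) (c : Chain (stdSimplex ℝ Y) (n + 1)) :
    ssd n (realize s n c) = realize s n (sd bary (n + 1) c) := by
  suffices ssd n ∘ₗ realize s n = realize s n ∘ₗ sd bary (n + 1) from LinearMap.congr_fun this c
  refine chain_hom_ext fun v => ?_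
  rw [LinearMap.comp_apply, realize_single, ssd_single, realize_comp_affine,
    push_sd (b := bary) (b' := bary) (f := affine v) fun m u => comb_bary v m u,
    push_affine_taut, LinearMap.comp_apply]

lemma ssdHomotopy_realize (s : C(stdSimplex ℝ Y, X)) (n : ℕ)
    (c : Chain (stdSimplex ℝ Y) (n + 1)) :
    ssdHomotopy n (realize s n c) = realize s (n + 1) (sdHomotopy bary (n + 1) c) := by
  suffices ssdHomotopy n ∘ₗ realize s n = realize s (n + 1) ∘ₗ sdHomotopy bary (n + 1) from
    LinearMap.congr_fun this c
  refine chain_hom_ext fun v => ?_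
  rw [LinearMap.comp_apply, realize_single, ssdHomotopy_single, realize_comp_affine,
    push_sdHomotopy (b := bary) (b' := bary) (f := affine v) fun m u => comb_bary v m u,
    push_affine_taut,
    LinearMap.comp_apply]

lemma sbd_ssd (n : ℕ) (c : SChain X (n + 1)) : sbd n (ssd (n + 1) c) = ssd n (sbd n c) := by
  suffices sbd (X := X) n ∘ₗ ssd (n + 1) = ssd n ∘ₗ sbd n from LinearMap.congr_fun this c
  refine schain_hom_ext fun s => ?_
  rw [LinearMap.comp_apply, LinearMap.comp_apply, ← realize_taut s, ssd_realize, sbd_realize,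
    sbd_realize, ssd_realize, bd_sd]

lemma sbd_ssdHomotopy (n : ℕ) (c : SChain X (n + 1)) :
    sbd (n + 1) (ssdHomotopy (n + 1) c) + ssdHomotopy n (sbd n c) = c - ssd (n + 1) c := by
  suffices sbd (X := X) (n + 1) ∘ₗ ssdHomotopy (n + 1) + ssdHomotopy n ∘ₗ sbd n =
    LinearMap.id - ssd (n + 1) from LinearMap.congr_fun this c
  refine schain_hom_ext fun s => ?_
  rw [LinearMap.add_apply, LinearMap.sub_apply, LinearMap.comp_apply, LinearMap.comp_apply,
    LinearMap.id_apply, ← realize_taut s, ssdHomotopy_realize, sbd_realize,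
    sbd_realize, ssdHomotopy_realize, ssd_realize, ← map_add, bd_sdHomotopy, map_sub]

section Small

variable {ι : Type*} (U : ι → Set X)

/-- A map is small with respect to a family of subsets if its range is contained in one of
them. -/
def IsSmall {T : Type*} [TopologicalSpace T] (s : C(T, X)) : Prop := ∃ i, ∀ p, s p ∈ U i

/-- The singular chains which are combinations of small simplices. -/
noncomputable def smallChains (n : ℕ) : Submodule ℤ (SChain X n) :=
  Finsupp.supported ℤ ℤ {s | IsSmall U s}

variable {U}

lemma IsSmall.comp {S T : Type*} [TopologicalSpace S] [TopologicalSpace T] {s : C(T, X)}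
    (hs : IsSmall U s) (f : C(S, T)) : IsSmall U (s.comp f) :=
  hs.imp fun _ h _ => h _

lemma realize_mem_smallChains {s : C(stdSimplex ℝ Y, X)} (hs : IsSmall U s) (n : ℕ)
    (c : Chain (stdSimplex ℝ Y) (n + 1)) : realize s n c ∈ smallChains U n := by
  have h : realize s n c ∈ (Finsupp.supported ℤ ℤ Set.univ).map (realize s n) :=
    Submodule.mem_map_of_mem (by simp)
  rw [realize, Finsupp.lmapDomain_supported] at h
  refine Finsupp.supported_mono ?_ h
  rintro _ ⟨v, -, rfl⟩
  exact hs.comp _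

lemma map_mem_smallChains {M : Type*} [AddCommGroup M] {n : ℕ} (f : SChain X n →ₗ[ℤ] M)
    (N : Submodule ℤ M) (h : ∀ s, IsSmall U s → f (Finsupp.single s 1) ∈ N) {c : SChain X n}
    (hc : c ∈ smallChains U n) : f c ∈ N := by
  rw [smallChains, Finsupp.supported_eq_span_single] at hc
  suffices Submodule.span ℤ _ ≤ N.comap f from this hc
  rw [Submodule.span_le]
  rintro _ ⟨s, hs, rfl⟩
  exact h s hs

lemma ssd_mem_smallChains {n : ℕ} {c : SChain X n} (hc : c ∈ smallChains U n) :
    ssd n c ∈ smallChains U n := by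
  refine map_mem_smallChains _ _ (fun s hs => ?_) hc
  rw [ssd_single]
  exact realize_mem_smallChains hs _ _

lemma ssdHomotopy_mem_smallChains {n : ℕ} {c : SChain X n} (hc : c ∈ smallChains U n) :
    ssdHomotopy n c ∈ smallChains U (n + 1) := by
  refine map_mem_smallChains _ _ (fun s hs => ?_) hc
  rw [ssdHomotopy_single]
  exact realize_mem_smallChains hs _ _

lemma iterate_ssd_realize (s : C(stdSimplex ℝ Y, X)) (n : ℕ) (c : Chain (stdSimplex ℝ Y) (n + 1))
    (N : ℕ) : (ssd n)^[N] (realize s n c) = realize s n ((sd bary (n + 1))^[N] c) := by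
  induction N with
  | zero => rfl
  | succ N ih => rw [Function.iterate_succ_apply', Function.iterate_succ_apply', ih, ssd_realize]

/-- Sufficiently fine subdivisions of a singular simplex are small with respect to an open
cover. -/
lemma exists_iterate_ssd_single_mem (hU : ∀ i, IsOpen (U i)) (hcover : ⋃ i, U i = Set.univ)
    {n : ℕ} (s : C(stdSimplex ℝ (Fin (n + 1)), X)) :
    ∃ N, (ssd n)^[N] (Finsupp.single s 1) ∈ smallChains U n := by
  obtain ⟨δ, hδ, hball⟩ := lebesgue_number_lemma_of_metric (s := Set.univ)
    (c := fun i => s ⁻¹' U i) isCompact_univ (fun i => (hU i).preimage s.continuous)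
    (by rw [← Set.preimage_iUnion, hcover, Set.preimage_univ])
  obtain ⟨N, hN⟩ : ∃ N : ℕ, (n / (n + 1) : ℝ) ^ N * 1 < δ := by
    obtain ⟨N, hN⟩ := exists_pow_lt_of_lt_one hδ (y := (n / (n + 1) : ℝ))
      (by rw [div_lt_one (by positivity)]; linarith)
    exact ⟨N, by rwa [mul_one]⟩
  refine ⟨N, ?_⟩
  have hd : ∀ i j : Fin (n + 1), dist (vertex i : stdSimplex ℝ (Fin (n + 1))) (vertex j) ≤ 1 := by
    intro i j
    exact (Metric.dist_le_diam_of_mem (bounded_stdSimplex (Fin (n + 1))) (vertex i).2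
      (vertex j).2).trans diam_stdSimplex_le
  have h1 := iterate_sd_finer (b := bary) (fun n v x s h => dist_comb_le v _ x s h)
    (fun n v d h i => dist_bary_le n v d h i) n vertex 1 hd N
  have h2 : realize s n ((sd bary (n + 1))^[N] (taut n)) ∈ Submodule.map (realize s n) _ :=
    Submodule.mem_map_of_mem h1
  rw [← realize_taut, iterate_ssd_realize]
  rw [realize, Finsupp.lmapDomain_supported] at h2
  refine Finsupp.supported_mono ?_ h2
  rintro _ ⟨w, ⟨-, hw⟩, rfl⟩
  obtain ⟨i, hi⟩ := hball (w 0) trivial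
  refine ⟨i, fun p => hi ?_⟩
  rw [Metric.mem_ball, dist_comm]
  exact (dist_comb_le w p (w 0) _ (fun j => hw 0 j)).trans_lt hN

lemma iterate_ssd_mem_smallChains {n : ℕ} {c : SChain X n} (hc : c ∈ smallChains U n) (N : ℕ) :
    (ssd n)^[N] c ∈ smallChains U n := by
  induction N with
  | zero => exact hc
  | succ N ih =>
    rw [Function.iterate_succ_apply']
    exact ssd_mem_smallChains ih

lemma exists_iterate_ssd_mem (hU : ∀ i, IsOpen (U i)) (hcover : ⋃ i, U i = Set.univ)
    {n : ℕ} (c : SChain X n) : ∃ N, (ssd n)^[N] c ∈ smallChains U n := by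
  induction c using Finsupp.induction_linear with
  | zero => exact ⟨0, Submodule.zero_mem _⟩
  | add f g hf hg =>
    obtain ⟨N, hN⟩ := hf
    obtain ⟨M, hM⟩ := hg
    refine ⟨N + M, ?_⟩
    rw [← Module.End.pow_apply, map_add, Module.End.pow_apply, Module.End.pow_apply]
    refine Submodule.add_mem _ ?_ ?_
    · rw [add_comm N M, Function.iterate_add_apply]
      exact iterate_ssd_mem_smallChains hN _
    · rw [Function.iterate_add_apply]
      exact iterate_ssd_mem_smallChains hM _
  | single s m =>
    obtain ⟨N, hN⟩ := exists_iterate_ssd_single_mem hU hcover s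
    refine ⟨N, ?_⟩
    rw [← Module.End.pow_apply] at hN ⊢
    rw [← mul_one m, ← smul_eq_mul, ← Finsupp.smul_single, map_smul]
    exact Submodule.smul_mem _ _ hN

/-- Singular chains modulo small chains are acyclic in positive degrees: a chain with small
boundary is a small chain up to a boundary. -/
lemma exists_sub_sbd_mem (hU : ∀ i, IsOpen (U i)) (hcover : ⋃ i, U i = Set.univ)
    {n : ℕ} (c : SChain X (n + 1)) (hc : sbd n c ∈ smallChains U n) :
    ∃ e, c - sbd (n + 1) e ∈ smallChains U (n + 1) := by
  have key : ∀ N, sbd n ((ssd (n + 1))^[N] c) ∈ smallChains U n ∧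
      ∃ e, c - (ssd (n + 1))^[N] c - sbd (n + 1) e ∈ smallChains U (n + 1) := by
    intro N
    induction N with
    | zero => exact ⟨hc, 0, by simp⟩
    | succ N ih =>
      obtain ⟨h1, e, h2⟩ := ih
      rw [Function.iterate_succ_apply']
      refine ⟨?_, e + ssdHomotopy (n + 1) ((ssd (n + 1))^[N] c), ?_⟩
      · rw [sbd_ssd]
        exact ssd_mem_smallChains h1
      · have h3 := Submodule.add_mem _ h2 (ssdHomotopy_mem_smallChains h1)
        have h4 := sbd_ssdHomotopy n ((ssd (n + 1))^[N] c)
        rw [← eq_sub_iff_add_eq'] at h4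
        rw [h4] at h3
        convert h3 using 1
        rw [map_add]
        abel
  obtain ⟨N, hN⟩ := exists_iterate_ssd_mem hU hcover c
  obtain ⟨-, e, he⟩ := key N
  exact ⟨e, by convert Submodule.add_mem _ he hN using 1; abel⟩

end Small

end SingularChain

section

open CategoryTheory Limits Simplicial Opposite

/-! ### The Mayer-Vietoris principle for Euler characteristics -/

namespace SingularChain

open SSet

variable {X : TopCat.{0}}

/-- The continuous map underlying a singular simplex. -/
noncomputable def toMap {n : ℕ} (x : (TopCat.toSSet.obj X) _⦋n⦌) :
    C(stdSimplex ℝ (Fin (n + 1)), X) :=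
  X.toSSetObjEquiv (op ⦋n⦌) x

lemma toMap_injective {n : ℕ} : Function.Injective (toMap (X := X) (n := n)) :=
  (X.toSSetObjEquiv (op ⦋n⦌)).injective

lemma toMap_surjective {n : ℕ} : Function.Surjective (toMap (X := X) (n := n)) :=
  (X.toSSetObjEquiv (op ⦋n⦌)).surjective

lemma toMap_naturality {Y : TopCat.{0}} (f : X ⟶ Y) {n : ℕ} (x : (TopCat.toSSet.obj X) _⦋n⦌) :
    toMap ((TopCat.toSSet.map f).app _ x) = f.hom.comp (toMap x) := rfl

lemma toMap_δ {n : ℕ} (i : Fin (n + 2)) (x : (TopCat.toSSet.obj X) _⦋n + 1⦌) :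
    toMap ((TopCat.toSSet.obj X).δ i x) = (toMap x).comp (vertexMap i.succAbove) := rfl

/-- Simplicial chains of the singular simplicial set are singular chains. -/
noncomputable def chainEquiv (X : TopCat.{0}) (n : ℕ) :
    (freeChains.obj (TopCat.toSSet.obj X)).X n ≃+ SChain X n :=
  Finsupp.domCongr (X.toSSetObjEquiv (op ⦋n⦌))

lemma chainEquiv_single {n : ℕ} (x : (TopCat.toSSet.obj X) _⦋n⦌) (m : ℤ) :
    chainEquiv X n (toChain _ n (Finsupp.single x m)) = Finsupp.single (toMap x) m :=
  Finsupp.equivMapDomain_single _ _ _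

lemma chainEquiv_toChain {n : ℕ} (c : (TopCat.toSSet.obj X) _⦋n⦌ →₀ ℤ) :
    chainEquiv X n (toChain _ n c) = c.mapDomain toMap :=
  Finsupp.equivMapDomain_eq_mapDomain _ _

lemma sbd_chainEquiv (n : ℕ) (c : (freeChains.obj (TopCat.toSSet.obj X)).X (n + 1)) :
    sbd n (chainEquiv X (n + 1) c) =
      chainEquiv X n ((freeChains.obj (TopCat.toSSet.obj X)).d (n + 1) n c) := by
  suffices ((sbd n).toAddMonoidHom.comp (chainEquiv X (n + 1)).toAddMonoidHom).comp
      (toChain _ (n + 1)).toAddMonoidHom = ((chainEquiv X n).toAddMonoidHom.comp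
        ((freeChains.obj (TopCat.toSSet.obj X)).d (n + 1) n).hom.toAddMonoidHom).comp
        (toChain _ (n + 1)).toAddMonoidHom from
    DFunLike.congr_fun this c
  refine Finsupp.addHom_ext' fun x => AddMonoidHom.ext_int ?_
  have h1 : chainEquiv X n ((freeChains.obj (TopCat.toSSet.obj X)).d (n + 1) n
      (toChain _ (n + 1) (Finsupp.single x 1))) =
      ∑ i : Fin (n + 2), (-1 : ℤ) ^ (i : ℕ) •
        Finsupp.single ((toMap x).comp (vertexMap i.succAbove)) 1 := by
    rw [freeChains_d_single, map_sum, map_sum]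
    refine Finset.sum_congr rfl fun i _ => ?_
    rw [map_zsmul, map_zsmul, chainEquiv_single, toMap_δ]
  have h2 : sbd n (chainEquiv X (n + 1) (toChain _ (n + 1) (Finsupp.single x 1))) =
      ∑ i : Fin (n + 2), (-1 : ℤ) ^ (i : ℕ) •
        Finsupp.single ((toMap x).comp (vertexMap i.succAbove)) 1 := by
    rw [chainEquiv_single, sbd_single]
  exact h2.trans h1.symm

variable {ι : Type*} (U : ι → Set X)

/-- The simplicial subset of small singular simplices. -/
noncomputable def smallSubcomplex : (TopCat.toSSet.obj X).Subcomplex where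
  obj n := {x | IsSmall U (X.toSSetObjEquiv n x)}
  map f _ hx := hx.comp ⟨stdSimplex.map f.unop, stdSimplex.continuous_map _⟩

lemma smallSubcomplex_ι_injective (n : ℕ) :
    Function.Injective ((smallSubcomplex U).ι.app (op ⦋n⦌)) :=
  Subtype.val_injective

lemma chainEquiv_mem_smallChains_iff {n : ℕ} (c : (freeChains.obj (TopCat.toSSet.obj X)).X n) :
    chainEquiv X n c ∈ smallChains U n ↔
      ∃ a, (freeChains.map (smallSubcomplex U).ι).f n a = c := by
  obtain ⟨c, rfl⟩ : ∃ c', toChain _ n c' = c := ⟨c, rfl⟩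
  have h1 : (∃ a, (freeChains.map (smallSubcomplex U).ι).f n a = toChain _ n c) ↔
      c ∈ Set.range (Finsupp.mapDomain (M := ℤ) ((smallSubcomplex U).ι.app (op ⦋n⦌))) := Iff.rfl
  rw [h1, Finsupp.mem_range_mapDomain_iff _ (smallSubcomplex_ι_injective U n),
    chainEquiv_toChain, smallChains, Finsupp.mem_supported']
  constructor
  · intro h x hx
    have := h (toMap x) fun hs => hx ⟨⟨x, hs⟩, rfl⟩
    rwa [Finsupp.mapDomain_apply toMap_injective] at this
  · intro h s hs
    obtain ⟨x, rfl⟩ := toMap_surjective s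
    rw [Finsupp.mapDomain_apply toMap_injective]
    refine h x ?_
    rintro ⟨y, rfl⟩
    exact hs y.2

lemma acyclic_cokernel_small (hU : ∀ i, IsOpen (U i)) (hcover : ⋃ i, U i = Set.univ) (n : ℕ) :
    (cokernel (freeChains.map (smallSubcomplex U).ι)).ExactAt n := by
  have := mono_freeChains_map (smallSubcomplex U).ι (smallSubcomplex_ι_injective U)
  set f := freeChains.map (smallSubcomplex U).ι with hf
  have comm : ∀ i j x, (cokernel f).d i j ((cokernel.π f).f i x) =
      (cokernel.π f).f j ((freeChains.obj (TopCat.toSSet.obj X)).d i j x) := fun i j x =>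
    congrArg (fun u => u.hom x) ((cokernel.π f).comm i j)
  cases n with
  | zero =>
    rw [HomologicalComplex.exactAt_iff' _ 1 0 0 (by simp) (by simp),
      ShortComplex.moduleCat_exact_iff]
    intro x _
    refine ⟨0, ?_⟩
    rw [map_zero]
    obtain ⟨c, rfl⟩ := cokernel_π_f_surjective f 0 x
    refine ((cokernel_π_f_eq_zero_iff f 0 c).2
      ((chainEquiv_mem_smallChains_iff U c).1 ?_)).symm
    rw [smallChains, Finsupp.mem_supported']
    intro s hs
    refine (hs ?_).elim
    obtain ⟨i, hi⟩ := Set.mem_iUnion.1 (hcover ▸ Set.mem_univ (s default))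
    exact ⟨i, fun p => by rwa [Subsingleton.elim p default]⟩
  | succ n =>
    rw [HomologicalComplex.exactAt_iff' _ (n + 2) (n + 1) n (by simp) (by simp),
      ShortComplex.moduleCat_exact_iff]
    intro x hx
    obtain ⟨c, rfl⟩ := cokernel_π_f_surjective f (n + 1) x
    have hx1 : sbd n (chainEquiv X (n + 1) c) ∈ smallChains U n := by
      rw [sbd_chainEquiv]
      exact (chainEquiv_mem_smallChains_iff U _).2
        ((cokernel_π_f_eq_zero_iff f n _).1 ((comm _ _ _).symm.trans hx))
    obtain ⟨e, he⟩ := exists_sub_sbd_mem hU hcover _ hx1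
    obtain ⟨e, rfl⟩ := (chainEquiv X (n + 2)).surjective e
    rw [sbd_chainEquiv, ← map_sub] at he
    have h2 := (cokernel_π_f_eq_zero_iff f (n + 1) _).2
      ((chainEquiv_mem_smallChains_iff U _).1 he)
    rw [map_sub, sub_eq_zero] at h2
    exact ⟨(cokernel.π f).f (n + 2) e, (comm _ _ _).trans h2.symm⟩

/-- The complex of integral simplicial chains of the singular simplicial set of a space. -/
noncomputable abbrev singularChains (X : TopCat.{0}) : ChainComplex (ModuleCat.{0} ℤ) ℕ :=
  freeChains.obj (TopCat.toSSet.obj X)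

lemma isFiniteType_of_acyclic {C : ChainComplex (ModuleCat.{0} ℤ) ℕ} (h : ∀ n, C.ExactAt n) :
    IsFiniteType (chainHomology C) ∧ gradedEuler (chainHomology C) = 0 := by
  have h' : ∀ n, Subsingleton (C.homology n) := fun n =>
    ModuleCat.subsingleton_of_isZero (h n).isZero_homology
  refine ⟨⟨fun i => inferInstance, 0, fun i _ => h' i⟩, ?_⟩
  rw [gradedEuler_eq_sum (N := 0) fun i _ => h' i, Finset.sum_range_zero]

/-- Small chains compute the finiteness and the Euler characteristic of singular homology. -/
lemma isFiniteType_of_small (hU : ∀ i, IsOpen (U i)) (hcover : ⋃ i, U i = Set.univ)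
    (h : IsFiniteType (chainHomology (freeChains.obj (smallSubcomplex U).toSSet))) :
    IsFiniteType (chainHomology (singularChains X)) ∧
      gradedEuler (chainHomology (singularChains X)) =
        gradedEuler (chainHomology (freeChains.obj (smallSubcomplex U).toSSet)) := by
  have := mono_freeChains_map (smallSubcomplex U).ι (smallSubcomplex_ι_injective U)
  have hS := shortExact_cokernel (freeChains.map (smallSubcomplex U).ι)
  obtain ⟨h3, h3'⟩ := isFiniteType_of_acyclic (acyclic_cokernel_small U hU hcover)
  have h2 := IsFiniteType.middle hS h h3
  exact ⟨h2, (gradedEuler_shortExact hS h h2 h3).trans (by rw [h3', add_zero])⟩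

end SingularChain

namespace SSet

variable {P A B S : SSet.{0}} (p : P ⟶ A) (q : P ⟶ B) (i : A ⟶ S) (j : B ⟶ S)

/-- Inclusion-exclusion for the Euler characteristic of a union of two simplicial subsets. -/
lemma gradedEuler_of_union (comm : p ≫ i = q ≫ j)
    (hi : ∀ n : ℕ, Function.Injective (i.app (op ⦋n⦌)))
    (hj : ∀ n : ℕ, Function.Injective (j.app (op ⦋n⦌)))
    (hp : ∀ n : ℕ, Function.Injective (p.app (op ⦋n⦌)))
    (hcover : ∀ (n : ℕ) (s : S _⦋n⦌), (∃ a, i.app _ a = s) ∨ ∃ b, j.app _ b = s)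
    (hinter : ∀ (n : ℕ) (a : A _⦋n⦌) (b : B _⦋n⦌), i.app _ a = j.app _ b → ∃ c, p.app _ c = a)
    (hP : IsFiniteType (chainHomology (freeChains.obj P)))
    (hA : IsFiniteType (chainHomology (freeChains.obj A)))
    (hB : IsFiniteType (chainHomology (freeChains.obj B))) :
    IsFiniteType (chainHomology (freeChains.obj S)) ∧
      gradedEuler (chainHomology (freeChains.obj S)) =
        gradedEuler (chainHomology (freeChains.obj A)) +
        gradedEuler (chainHomology (freeChains.obj B)) -
        gradedEuler (chainHomology (freeChains.obj P)) := by
  have hS₁ := shortExact_of_union p q i j comm hi hj hp hcover hinter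
  have := mono_freeChains_map j hj
  have hS₂ := shortExact_cokernel (freeChains.map j)
  have hQ := IsFiniteType.third hS₁ hP hA
  have hS := IsFiniteType.middle hS₂ hB hQ
  have e₁ := gradedEuler_shortExact hS₁ hP hA hQ
  have e₂ := gradedEuler_shortExact hS₂ hB hS hQ
  dsimp only at e₁ e₂
  exact ⟨hS, by linarith⟩

end SSet

namespace SingularChain

open SSet

variable {X : TopCat.{0}}

/-- The inclusion of a subspace in a larger one. -/
def inclusionHom {V W : Set X} (h : V ⊆ W) : TopCat.of V ⟶ TopCat.of W :=
  TopCat.ofHom ⟨Set.inclusion h, continuous_inclusion h⟩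

/-- The inclusion of a subspace in the whole space. -/
def valHom (V : Set X) : TopCat.of V ⟶ X := TopCat.ofHom ⟨Subtype.val, continuous_subtype_val⟩

/-- The singular simplices of a member of a family of subsets are small. -/
noncomputable def toSmall {ι : Type*} (U : ι → Set X) (k : ι) :
    TopCat.toSSet.obj (TopCat.of (U k)) ⟶ (smallSubcomplex U).toSSet :=
  Subfunctor.lift (TopCat.toSSet.map (valHom (U k))) <| by
    rintro n _ ⟨x, rfl⟩
    exact ⟨k, fun p => ((TopCat.of (U k)).toSSetObjEquiv n x p).2⟩

lemma toSSet_map_injective {Y : TopCat.{0}} (f : X ⟶ Y) (hf : Function.Injective f) (n : ℕ) :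
    Function.Injective ((TopCat.toSSet.map f).app (op ⦋n⦌)) := by
  intro x y h
  refine toMap_injective (ContinuousMap.ext fun p => hf ?_)
  have := congrArg toMap h
  rw [toMap_naturality, toMap_naturality] at this
  exact DFunLike.congr_fun this p

lemma toSmall_injective {ι : Type*} (U : ι → Set X) (k : ι) (n : ℕ) :
    Function.Injective ((toSmall U k).app (op ⦋n⦌)) := by
  intro x y h
  exact toSSet_map_injective (valHom (U k)) Subtype.val_injective n (congrArg Subtype.val h)

lemma exists_toSSet_val {V : Set X} {n : ℕ} (x : (TopCat.toSSet.obj X) _⦋n⦌)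
    (hx : ∀ p, toMap x p ∈ V) : ∃ y, (TopCat.toSSet.map (valHom V)).app _ y = x := by
  obtain ⟨y, hy⟩ := toMap_surjective (X := TopCat.of V) (n := n)
    ⟨fun p => ⟨toMap x p, hx p⟩, (toMap x).continuous.subtype_mk _⟩
  refine ⟨y, toMap_injective ?_⟩
  rw [toMap_naturality, hy]
  rfl

/-- Inclusion-exclusion for the Euler characteristic of a union of two open subsets. -/
theorem gradedEuler_union (V W : Set X) (hV : IsOpen V) (hW : IsOpen W) (hVW : V ∪ W = Set.univ)
    (h₁ : IsFiniteType (chainHomology (singularChains (TopCat.of V))))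
    (h₂ : IsFiniteType (chainHomology (singularChains (TopCat.of W))))
    (h₃ : IsFiniteType (chainHomology (singularChains (TopCat.of (V ∩ W : Set X))))) :
    IsFiniteType (chainHomology (singularChains X)) ∧
      gradedEuler (chainHomology (singularChains X)) =
        gradedEuler (chainHomology (singularChains (TopCat.of V))) +
        gradedEuler (chainHomology (singularChains (TopCat.of W))) -
        gradedEuler (chainHomology (singularChains (TopCat.of (V ∩ W : Set X)))) := by
  let U : Bool → Set X := fun b => cond b V W
  have hU : ∀ b, IsOpen (U b) := by rintro (_ | _) <;> assumption
  have hcover : ⋃ b, U b = Set.univ := by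
    rw [← hVW, Set.union_eq_iUnion]
  have hinj : Function.Injective
      (inclusionHom (X := X) (V := V ∩ W) (W := V) Set.inter_subset_left) :=
    Set.inclusion_injective Set.inter_subset_left
  have key := SSet.gradedEuler_of_union
    (TopCat.toSSet.map (inclusionHom (X := X) (V := V ∩ W) (W := V) Set.inter_subset_left))
    (TopCat.toSSet.map (inclusionHom (X := X) (V := V ∩ W) (W := W) Set.inter_subset_right))
    (toSmall U true) (toSmall U false) rfl
    (toSmall_injective U true) (toSmall_injective U false)
    (toSSet_map_injective _ hinj) ?_ ?_ h₃ h₁ h₂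
  · obtain ⟨h4, h5⟩ := isFiniteType_of_small U hU hcover key.1
    exact ⟨h4, h5.trans key.2⟩
  · rintro n ⟨s, b, hs⟩
    cases b with
    | true =>
      obtain ⟨y, hy⟩ := exists_toSSet_val (V := V) s hs
      exact Or.inl ⟨y, Subtype.ext hy⟩
    | false =>
      obtain ⟨y, hy⟩ := exists_toSSet_val (V := W) s hs
      exact Or.inr ⟨y, Subtype.ext hy⟩
  · intro n a b hab
    have hab' : (valHom V).hom.comp (toMap a) = (valHom W).hom.comp (toMap b) :=
      congrArg toMap (congrArg Subtype.val hab)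
    have hmem : ∀ p, (toMap a p).1 ∈ V ∩ W := fun p => by
      have h : (toMap a p).1 = (toMap b p).1 := DFunLike.congr_fun hab' p
      exact ⟨(toMap a p).2, h ▸ (toMap b p).2⟩
    obtain ⟨y, hy⟩ := toMap_surjective (X := TopCat.of (V ∩ W : Set X)) (n := n)
      ⟨fun p => ⟨toMap a p, hmem p⟩,
        (continuous_subtype_val.comp (toMap a).continuous).subtype_mk _⟩
    refine ⟨y, toMap_injective ?_⟩
    rw [toMap_naturality, hy]
    rfl

/-- The integral homology of a space in terms of the free chains on its singular simplices. -/
noncomputable def integralHomologyIso (Y : Type) [TopologicalSpace Y] (i : ℕ) :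
    integralHomology Y i ≅ (singularChains (TopCat.of Y)).homology i :=
  (HomologicalComplex.homologyFunctor _ _ i).mapIso
    (SSet.chainComplexIsoFreeChains.app (TopCat.toSSet.obj (TopCat.of Y)))

end SingularChain

/-- The integral homology of a space as a graded abelian group. -/
noncomputable abbrev totalHomology (Y : Type) [TopologicalSpace Y] : ℕ → ModuleCat.{0} ℤ :=
  fun i => integralHomology Y i

lemma hasFiniteHomology_iff (Y : Type) [TopologicalSpace Y] :
    HasFiniteHomology Y ↔ IsFiniteType (totalHomology Y) := by
  constructor
  · rintro ⟨h1, h2⟩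
    refine ⟨h1, ?_⟩
    obtain ⟨N, hN⟩ := h2.bddAbove
    refine ⟨N + 1, fun i hi => ?_⟩
    by_contra hi'
    rw [not_subsingleton_iff_nontrivial] at hi'
    have := hN hi'
    omega
  · rintro ⟨h1, N, hN⟩
    refine ⟨h1, (Set.finite_lt_nat N).subset fun i hi => ?_⟩
    by_contra hi'
    exact not_subsingleton_iff_nontrivial.2 hi (hN i (not_lt.1 hi'))

/-- The space `Y` has finite homology and Euler characteristic `n`. -/
def HasEuler (Y : Type) [TopologicalSpace Y] (n : ℤ) : Prop :=
  HasFiniteHomology Y ∧ eulerCharacteristic Y = n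

lemma hasEuler_iff {Y : Type} [TopologicalSpace Y] {n : ℤ} : HasEuler Y n ↔
    IsFiniteType (chainHomology (SingularChain.singularChains (TopCat.of Y))) ∧
      gradedEuler (chainHomology (SingularChain.singularChains (TopCat.of Y))) = n := by
  rw [HasEuler, hasFiniteHomology_iff]
  have h := gradedEuler_congr (H := totalHomology Y) (SingularChain.integralHomologyIso Y)
  exact and_congr ⟨IsFiniteType.of_iso (SingularChain.integralHomologyIso Y),
    IsFiniteType.of_iso fun i => (SingularChain.integralHomologyIso Y i).symm⟩
    (by rw [← h]; rfl)

/-- Inclusion-exclusion for the Euler characteristic of a union of two open subsets. -/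
theorem HasEuler.union {Y : Type} [TopologicalSpace Y] {V W : Set Y} (hV : IsOpen V)
    (hW : IsOpen W) (hVW : V ∪ W = Set.univ) {a b c : ℤ} (h₁ : HasEuler V a) (h₂ : HasEuler W b)
    (h₃ : HasEuler (V ∩ W : Set Y) c) : HasEuler Y (a + b - c) := by
  rw [hasEuler_iff] at *
  obtain ⟨h, e⟩ := SingularChain.gradedEuler_union (X := TopCat.of Y) V W hV hW hVW h₁.1 h₂.1 h₃.1
  exact ⟨h, e.trans (by rw [h₁.2, h₂.2, h₃.2])⟩

end

section

open CategoryTheory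

/-! ### Euler characteristics of real moment-angle complexes -/

/-- Homotopy equivalent spaces have isomorphic homology. -/
noncomputable def integralHomologyIsoOfHomotopyEquiv {X Y : Type} [TopologicalSpace X]
    [TopologicalSpace Y] (e : ContinuousMap.HomotopyEquiv X Y) (i : ℕ) :
    integralHomology X i ≅ integralHomology Y i where
  hom := ((AlgebraicTopology.singularHomologyFunctor (ModuleCat.{0} ℤ) i).obj
    (ModuleCat.of ℤ ℤ)).map (TopCat.ofHom e.toFun)
  inv := ((AlgebraicTopology.singularHomologyFunctor (ModuleCat.{0} ℤ) i).obj
    (ModuleCat.of ℤ ℤ)).map (TopCat.ofHom e.invFun)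
  hom_inv_id := (Functor.map_comp _ _ _).symm.trans
    ((TopCat.Homotopy.congr_homologyMap_singularChainComplexFunctor
      (X := TopCat.of X) (Y := TopCat.of X)
      (f := TopCat.ofHom e.toFun ≫ TopCat.ofHom e.invFun) (g := 𝟙 _)
      e.left_inv.some (ModuleCat.of ℤ ℤ) i).trans (CategoryTheory.Functor.map_id
        ((AlgebraicTopology.singularHomologyFunctor (ModuleCat.{0} ℤ) i).obj (ModuleCat.of ℤ ℤ))
        (TopCat.of X)))
  inv_hom_id := (Functor.map_comp _ _ _).symm.trans
    ((TopCat.Homotopy.congr_homologyMap_singularChainComplexFunctor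
      (X := TopCat.of Y) (Y := TopCat.of Y)
      (f := TopCat.ofHom e.invFun ≫ TopCat.ofHom e.toFun) (g := 𝟙 _)
      e.right_inv.some (ModuleCat.of ℤ ℤ) i).trans (CategoryTheory.Functor.map_id
        ((AlgebraicTopology.singularHomologyFunctor (ModuleCat.{0} ℤ) i).obj (ModuleCat.of ℤ ℤ))
        (TopCat.of Y)))

lemma HasEuler.of_homotopyEquiv {X Y : Type} [TopologicalSpace X] [TopologicalSpace Y] {n : ℤ}
    (h : HasEuler Y n) (e : ContinuousMap.HomotopyEquiv X Y) : HasEuler X n := by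
  rw [HasEuler, hasFiniteHomology_iff] at *
  refine ⟨h.1.of_iso fun i => (integralHomologyIsoOfHomotopyEquiv e i).symm, ?_⟩
  rw [← h.2]
  exact gradedEuler_congr (integralHomologyIsoOfHomotopyEquiv e)

lemma hasEuler_of_finite (X : Type) [TopologicalSpace X] [Fintype X]
    [TotallyDisconnectedSpace X] : HasEuler X (Fintype.card X) := by
  have h1 : ∀ i, 1 ≤ i → Subsingleton (integralHomology X i) := fun i hi =>
    ModuleCat.subsingleton_of_isZero
      (AlgebraicTopology.isZero_singularHomologyFunctor_of_totallyDisconnectedSpace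
        (ModuleCat.{0} ℤ) i (ModuleCat.of ℤ ℤ) (TopCat.of X) (by omega))
  have e : integralHomology X 0 ≅ ModuleCat.of ℤ (X →₀ ℤ) :=
    AlgebraicTopology.singularHomologyFunctorZeroOfTotallyDisconnectedSpace
      (ModuleCat.{0} ℤ) (ModuleCat.of ℤ ℤ) (TopCat.of X) ≪≫ sigmaConstIntIso.app X
  have h0 : Module.Finite ℤ (integralHomology X 0) := Module.Finite.equiv e.symm.toLinearEquiv
  rw [HasEuler, hasFiniteHomology_iff]
  refine ⟨⟨fun i => ?_, 1, h1⟩, ?_⟩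
  · rcases Nat.eq_zero_or_pos i with rfl | hi
    · exact h0
    · have := h1 i hi
      infer_instance
  · refine (gradedEuler_eq_sum (H := totalHomology X) h1).trans ?_
    rw [Finset.sum_range_one, pow_zero, one_mul, e.toLinearEquiv.finrank_eq]
    exact congrArg _ (Module.finrank_finsupp_self ℤ)

/-- The real moment-angle complex of a family of finite subsets of `Fin m`. The family may be
empty, so that the links of vertices which do not belong to a complex are covered. -/
def cubeSubset {m : ℕ} (F : Set (Finset (Fin m))) : Set (Fin m → OneDisc) :=
  ⋃ σ ∈ F, {x | ∀ i, i ∉ σ → x i ∈ zeroSphere}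

lemma mem_cubeSubset {m : ℕ} {F : Set (Finset (Fin m))} {x : Fin m → OneDisc} :
    x ∈ cubeSubset F ↔ ∃ σ ∈ F, ∀ i, i ∉ σ → x i ∈ zeroSphere := by
  simp [cubeSubset]

/-- The members of a family which avoid the first vertex. -/
def deletion {m : ℕ} (F : Set (Finset (Fin (m + 1)))) : Set (Finset (Fin m)) :=
  {σ | σ.map (Fin.succEmb m) ∈ F}

/-- The link of the first vertex in a family. -/
def linkZero {m : ℕ} (F : Set (Finset (Fin (m + 1)))) : Set (Finset (Fin m)) :=
  {σ | insert 0 (σ.map (Fin.succEmb m)) ∈ F}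

lemma deletion_isLowerSet {m : ℕ} {F : Set (Finset (Fin (m + 1)))} (hF : IsLowerSet F) :
    IsLowerSet (deletion F) := fun _ _ h hσ => hF (Finset.map_subset_map.2 h) hσ

lemma linkZero_isLowerSet {m : ℕ} {F : Set (Finset (Fin (m + 1)))} (hF : IsLowerSet F) :
    IsLowerSet (linkZero F) := fun _ _ h hσ =>
  hF (Finset.insert_subset_insert 0 (Finset.map_subset_map.2 h)) hσ

/-- Restriction of a finite set of vertices to the vertices other than the first. -/
def tailSet {m : ℕ} (σ : Finset (Fin (m + 1))) : Finset (Fin m) :=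
  Finset.univ.filter fun i => i.succ ∈ σ

lemma map_tailSet_of_notMem {m : ℕ} {σ : Finset (Fin (m + 1))} (h : 0 ∉ σ) :
    (tailSet σ).map (Fin.succEmb m) = σ := by
  ext i
  refine Fin.cases ?_ (fun i => ?_) i
  · simp [h]
  · simp [tailSet]

lemma insert_map_tailSet {m : ℕ} {σ : Finset (Fin (m + 1))} (h : 0 ∈ σ) :
    insert 0 ((tailSet σ).map (Fin.succEmb m)) = σ := by
  ext i
  refine Fin.cases ?_ (fun i => ?_) i
  · simp [h]
  · simp [tailSet]

lemma map_tailSet_subset {m : ℕ} (σ : Finset (Fin (m + 1))) :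
    (tailSet σ).map (Fin.succEmb m) ⊆ σ := by
  intro i
  refine Fin.cases ?_ (fun i => ?_) i <;> simp [tailSet]

lemma tail_mem_deletion {m : ℕ} {F : Set (Finset (Fin (m + 1)))} (hF : IsLowerSet F)
    {x : Fin (m + 1) → OneDisc} (hx : x ∈ cubeSubset F) :
    Fin.tail x ∈ cubeSubset (deletion F) := by
  obtain ⟨σ, hσ, h⟩ := mem_cubeSubset.1 hx
  exact mem_cubeSubset.2 ⟨tailSet σ, hF (map_tailSet_subset σ) hσ,
    fun i hi => h _ (by simpa [tailSet] using hi)⟩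

lemma tail_mem_linkZero {m : ℕ} {F : Set (Finset (Fin (m + 1)))}
    {x : Fin (m + 1) → OneDisc} (hx : x ∈ cubeSubset F) (hx0 : x 0 ∉ zeroSphere) :
    Fin.tail x ∈ cubeSubset (linkZero F) := by
  obtain ⟨σ, hσ, h⟩ := mem_cubeSubset.1 hx
  have h0 : 0 ∈ σ := by
    by_contra h0
    exact hx0 (h 0 h0)
  exact mem_cubeSubset.2 ⟨tailSet σ, by rwa [linkZero, Set.mem_ofPred_eq, insert_map_tailSet h0],
    fun i hi => h _ (by simpa [tailSet] using hi)⟩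

lemma cons_mem_of_deletion {m : ℕ} {F : Set (Finset (Fin (m + 1)))} {t : OneDisc}
    (ht : t ∈ zeroSphere) {y : Fin m → OneDisc} (hy : y ∈ cubeSubset (deletion F)) :
    (Fin.cons t y : Fin (m + 1) → OneDisc) ∈ cubeSubset F := by
  obtain ⟨σ, hσ, h⟩ := mem_cubeSubset.1 hy
  refine mem_cubeSubset.2 ⟨_, hσ, fun i => ?_⟩
  refine Fin.cases ?_ (fun i => ?_) i
  · exact fun _ => ht
  · intro hi
    exact h i (by simpa using hi)

lemma cons_mem_of_linkZero {m : ℕ} {F : Set (Finset (Fin (m + 1)))} (t : OneDisc)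
    {y : Fin m → OneDisc} (hy : y ∈ cubeSubset (linkZero F)) :
    (Fin.cons t y : Fin (m + 1) → OneDisc) ∈ cubeSubset F := by
  obtain ⟨σ, hσ, h⟩ := mem_cubeSubset.1 hy
  refine mem_cubeSubset.2 ⟨_, hσ, fun i => ?_⟩
  refine Fin.cases ?_ (fun i => ?_) i
  · simp
  · intro hi
    exact h i (by simpa using hi)

lemma cons_mem_of_mem {m : ℕ} {F : Set (Finset (Fin (m + 1)))} {x : Fin (m + 1) → OneDisc}
    (hx : x ∈ cubeSubset F) {t : OneDisc} (ht : x 0 ∈ zeroSphere → t ∈ zeroSphere) :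
    (Fin.cons t (Fin.tail x) : Fin (m + 1) → OneDisc) ∈ cubeSubset F := by
  obtain ⟨σ, hσ, h⟩ := mem_cubeSubset.1 hx
  refine mem_cubeSubset.2 ⟨σ, hσ, fun i => ?_⟩
  refine Fin.cases ?_ (fun i => ?_) i
  · exact fun hi => ht (h 0 hi)
  · exact fun hi => h _ hi

/-- The point of the interval `[-1, 1]` at time `s` on the segment from `a` to `b`. -/
def segPoint (a b : OneDisc) (s : unitInterval) : OneDisc :=
  ⟨(1 - (s : ℝ)) * a + s * b,
    (convex_Icc (-1 : ℝ) 1) a.2 b.2 (sub_nonneg.2 s.2.2) s.2.1 (by ring)⟩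

lemma continuous_segPoint : Continuous fun p : unitInterval × OneDisc × OneDisc =>
    segPoint p.2.1 p.2.2 p.1 := by
  unfold segPoint
  fun_prop

lemma continuous_coord {m : ℕ} (S : Set (Fin m → OneDisc)) (i : Fin m) :
    Continuous fun y : S => y.1 i :=
  (continuous_apply i).comp continuous_subtype_val

/-- A subspace `V` of the moment-angle complex which is preserved by moving the first coordinate
to `b` along segments is homotopy equivalent to its slice at `b`, if that slice is the
moment-angle complex of the family `G`. -/
noncomputable def sliceEquiv {m : ℕ} {F : Set (Finset (Fin (m + 1)))} {G : Set (Finset (Fin m))}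
    (V : Set (cubeSubset F)) (b : OneDisc)
    (htail : ∀ x ∈ V, Fin.tail x.1 ∈ cubeSubset G)
    (hcons : ∀ y ∈ cubeSubset G, ∃ h : (Fin.cons b y : Fin (m + 1) → OneDisc) ∈ cubeSubset F,
      ⟨_, h⟩ ∈ V)
    (hmove : ∀ x ∈ V, ∀ s, ∃ h : (Fin.cons (segPoint b (x.1 0) s) (Fin.tail x.1) :
      Fin (m + 1) → OneDisc) ∈ cubeSubset F, ⟨_, h⟩ ∈ V) :
    ContinuousMap.HomotopyEquiv V (cubeSubset G) where
  toFun := ⟨fun x => ⟨Fin.tail x.1.1, htail _ x.2⟩,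
    Continuous.subtype_mk (continuous_pi fun i : Fin m =>
      ((continuous_coord _ i.succ).comp continuous_subtype_val :
        Continuous fun x : V => x.1.1 i.succ)) _⟩
  invFun := ⟨fun y => ⟨⟨Fin.cons b y.1, (hcons _ y.2).1⟩, (hcons _ y.2).2⟩, by
    refine Continuous.subtype_mk (Continuous.subtype_mk (continuous_pi fun i => ?_) _) _
    refine Fin.cases ?_ (fun i => ?_) i
    · simpa using continuous_const
    · simpa only [Fin.cons_succ] using continuous_coord _ i⟩
  left_inv := ⟨{
    toFun := fun p => ⟨⟨Fin.cons (segPoint b (p.2.1.1 0) p.1) (Fin.tail p.2.1.1),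
      (hmove _ p.2.2 p.1).1⟩, (hmove _ p.2.2 p.1).2⟩
    continuous_toFun := by
      refine Continuous.subtype_mk (Continuous.subtype_mk (continuous_pi fun i => ?_) _) _
      refine Fin.cases ?_ (fun i => ?_) i
      · simp only [Fin.cons_zero]
        exact continuous_segPoint.comp (continuous_fst.prodMk (continuous_const.prodMk
          ((continuous_coord _ 0).comp (continuous_subtype_val.comp continuous_snd))))
      · simp only [Fin.cons_succ, Fin.tail]
        exact (continuous_coord _ i.succ).comp (continuous_subtype_val.comp continuous_snd)
    map_zero_left := fun x => by
      refine Subtype.ext (Subtype.ext ?_)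
      change (Fin.cons (segPoint b (x.1.1 0) 0) (Fin.tail x.1.1) : Fin (m + 1) → OneDisc) =
        Fin.cons b (Fin.tail x.1.1)
      congr 1
      exact Subtype.ext (by simp [segPoint])
    map_one_left := fun x => by
      refine Subtype.ext (Subtype.ext ?_)
      change (Fin.cons (segPoint b (x.1.1 0) 1) (Fin.tail x.1.1) : Fin (m + 1) → OneDisc) = x.1.1
      have : segPoint b (x.1.1 0) 1 = x.1.1 0 := Subtype.ext (by simp [segPoint])
      rw [this, Fin.cons_self_tail] }⟩
  right_inv := by
    rw [show ContinuousMap.comp _ _ = ContinuousMap.id (cubeSubset G) from rfl]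

/-- The Euler characteristic of the moment-angle complex of a family of finite sets, computed by
counting cubes. -/
noncomputable def cubeEuler {m : ℕ} (F : Set (Finset (Fin m))) : ℤ := by
  classical
  exact ∑ σ : Finset (Fin m), if σ ∈ F then (-1) ^ σ.card * 2 ^ (m - σ.card) else 0

lemma sum_finset_fin_succ {m : ℕ} (f : Finset (Fin (m + 1)) → ℤ) :
    ∑ σ, f σ = ∑ σ : Finset (Fin m), f (σ.map (Fin.succEmb m)) +
      ∑ σ : Finset (Fin m), f (insert 0 (σ.map (Fin.succEmb m))) := by
  classical
  rw [← Finset.sum_filter_not_add_sum_filter Finset.univ (fun σ : Finset (Fin (m + 1)) => 0 ∈ σ)]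
  congr 1
  · refine Finset.sum_bij' (fun σ _ => tailSet σ) (fun σ _ => σ.map (Fin.succEmb m)) (by simp)
      (by simp) (fun σ hσ => map_tailSet_of_notMem (Finset.mem_filter.1 hσ).2)
      (fun σ _ => by ext; simp [tailSet])
      (fun σ hσ => by rw [map_tailSet_of_notMem (Finset.mem_filter.1 hσ).2])
  · refine Finset.sum_bij' (fun σ _ => tailSet σ) (fun σ _ => insert 0 (σ.map (Fin.succEmb m)))
      (by simp) (by simp) (fun σ hσ => insert_map_tailSet (Finset.mem_filter.1 hσ).2)
      (fun σ _ => by ext; simp [tailSet])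
      (fun σ hσ => by rw [insert_map_tailSet (Finset.mem_filter.1 hσ).2])

lemma cubeEuler_succ {m : ℕ} (F : Set (Finset (Fin (m + 1)))) :
    cubeEuler F = 2 * cubeEuler (deletion F) - cubeEuler (linkZero F) := by
  classical
  unfold cubeEuler
  rw [sum_finset_fin_succ, Finset.mul_sum, sub_eq_add_neg, ← Finset.sum_neg_distrib]
  congr 1 <;> refine Finset.sum_congr rfl fun σ _ => ?_
  · have : σ.card ≤ m := by simpa using Finset.card_le_univ σ
    by_cases h : σ ∈ deletion F
    · rw [if_pos h, if_pos (show σ.map (Fin.succEmb m) ∈ F from h), Finset.card_map,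
        Nat.succ_sub this, pow_succ]
      ring
    · rw [if_neg h, if_neg (show σ.map (Fin.succEmb m) ∉ F from h), mul_zero]
  · have h0 : (0 : Fin (m + 1)) ∉ σ.map (Fin.succEmb m) := by simp
    by_cases h : σ ∈ linkZero F
    · rw [if_pos h, if_pos (show insert 0 (σ.map (Fin.succEmb m)) ∈ F from h),
        Finset.card_insert_of_notMem h0, Finset.card_map, pow_succ, Nat.add_sub_add_right]
      ring
    · rw [if_neg h, if_neg (show insert 0 (σ.map (Fin.succEmb m)) ∉ F from h), neg_zero]

/-- The moment-angle complex of a lower family has finite homology, and its Euler characteristic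
is the alternating number of cubes. -/
theorem hasEuler_cubeSubset {m : ℕ} (F : Set (Finset (Fin m))) (hF : IsLowerSet F) :
    HasEuler (cubeSubset F) (cubeEuler F) := by
  induction m with
  | zero =>
    classical
    have hE : cubeEuler F = if ∅ ∈ F then 1 else 0 := by
      rw [cubeEuler, Fintype.sum_unique, Subsingleton.elim default ∅]
      by_cases h : ∅ ∈ F <;> simp [h]
    by_cases h : ∅ ∈ F
    · have : Unique (cubeSubset F) :=
        { default := ⟨fun i => i.elim0, mem_cubeSubset.2 ⟨∅, h, fun i => i.elim0⟩⟩
          uniq := fun x => Subtype.ext (Subsingleton.elim _ _) }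
      rw [show cubeEuler F = Fintype.card (cubeSubset F) by simp [hE, h]]
      exact hasEuler_of_finite _
    · have : IsEmpty (cubeSubset F) := ⟨fun x => by
        obtain ⟨σ, hσ, -⟩ := mem_cubeSubset.1 x.2
        rw [Subsingleton.elim σ ∅] at hσ
        exact h hσ⟩
      have : Fintype (cubeSubset F) := Fintype.ofIsEmpty
      rw [show cubeEuler F = Fintype.card (cubeSubset F) by simp [hE, h]]
      exact hasEuler_of_finite _
  | succ m ih =>
    have hd := ih _ (deletion_isLowerSet hF)
    have hl := ih _ (linkZero_isLowerSet hF)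
    let V : Set (cubeSubset F) := {x | (-1 : ℝ) < x.1 0}
    let W : Set (cubeSubset F) := {x | (x.1 0 : ℝ) < 1}
    have hc : Continuous fun x : cubeSubset F => (x.1 0 : ℝ) :=
      continuous_subtype_val.comp (continuous_coord _ 0)
    have hV : IsOpen V := isOpen_lt continuous_const hc
    have hW : IsOpen W := isOpen_lt hc continuous_const
    have hVW : V ∪ W = Set.univ := by
      refine Set.eq_univ_of_forall fun x => ?_
      rcases lt_or_ge (-1 : ℝ) (x.1 0) with h | h
      · exact Or.inl h
      · exact Or.inr (show (x.1 0 : ℝ) < 1 by linarith)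
    have hVd : HasEuler V (cubeEuler (deletion F)) := by
      refine hd.of_homotopyEquiv (sliceEquiv V ⟨1, by norm_num⟩
        (fun x _ => tail_mem_deletion hF x.2)
        (fun y hy => ⟨cons_mem_of_deletion (Or.inr rfl) hy, by simp [V]⟩)
        fun x hx s => ⟨cons_mem_of_mem x.2 fun h0 => ?_, ?_⟩)
      · have h1 : (x.1 0 : ℝ) = 1 := h0.resolve_left (ne_of_gt hx)
        exact Or.inr (by simp [segPoint, h1])
      · exact (convex_Ioi (-1 : ℝ)) (show (1 : ℝ) ∈ Set.Ioi (-1) by norm_num) hx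
          (sub_nonneg.2 s.2.2) s.2.1 (by ring)
    have hWd : HasEuler W (cubeEuler (deletion F)) := by
      refine hd.of_homotopyEquiv (sliceEquiv W ⟨-1, by norm_num⟩
        (fun x _ => tail_mem_deletion hF x.2)
        (fun y hy => ⟨cons_mem_of_deletion (Or.inl rfl) hy, by simp [W]⟩)
        fun x hx s => ⟨cons_mem_of_mem x.2 fun h0 => ?_, ?_⟩)
      · have h1 : (x.1 0 : ℝ) = -1 := h0.resolve_right (ne_of_lt hx)
        exact Or.inl (by simp [segPoint, h1]; try ring)
      · exact (convex_Iio (1 : ℝ)) (show (-1 : ℝ) ∈ Set.Iio 1 by norm_num) hx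
          (sub_nonneg.2 s.2.2) s.2.1 (by ring)
    have hl' : HasEuler (V ∩ W : Set (cubeSubset F)) (cubeEuler (linkZero F)) := by
      have hn : ∀ x ∈ V ∩ W, x.1 0 ∉ zeroSphere := by
        rintro x ⟨h1, h2⟩ (h | h)
        · exact ne_of_gt h1 h
        · exact ne_of_lt h2 h
      refine hl.of_homotopyEquiv (sliceEquiv (V ∩ W) ⟨0, by norm_num⟩
        (fun x hx => tail_mem_linkZero x.2 (hn x hx))
        (fun y hy => ⟨cons_mem_of_linkZero _ hy, by simp [V], by simp [W]⟩)
        fun x hx s => ⟨cons_mem_of_mem x.2 fun h0 => (hn x hx h0).elim, ?_, ?_⟩)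
      · exact (convex_Ioi (-1 : ℝ)) (show (0 : ℝ) ∈ Set.Ioi (-1) by norm_num) hx.1
          (sub_nonneg.2 s.2.2) s.2.1 (by ring)
      · exact (convex_Iio (1 : ℝ)) (show (0 : ℝ) ∈ Set.Iio 1 by norm_num) hx.2
          (sub_nonneg.2 s.2.2) s.2.1 (by ring)
    have := HasEuler.union hV hW hVW hVd hWd hl'
    rwa [cubeEuler_succ, two_mul]

end

lemma PreAbstractSimplicialComplex.isLowerSet_simplices {V : Type*}
    (K : PreAbstractSimplicialComplex V) : IsLowerSet K.simplices := by
  rintro σ τ h (rfl | hσ)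
  · exact Or.inl (Finset.subset_empty.1 h)
  · rcases τ.eq_empty_or_nonempty with rfl | hτ
    · exact Or.inl rfl
    · exact Or.inr ((K.isRelLowerSet_faces hσ).2 h hτ)

lemma cubeEuler_simplices {m : ℕ} (K : PreAbstractSimplicialComplex (Fin m)) :
    cubeEuler K.simplices = ∑ k ∈ Finset.range (m + 1),
      (-1 : ℤ) ^ k * (K.numSimplices ((k : ℤ) - 1) : ℤ) * 2 ^ (m - k) := by
  classical
  unfold cubeEuler
  rw [← Finset.sum_filter, ← Finset.sum_fiberwise_of_maps_to (s := Finset.univ.filter _)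
    (t := Finset.range (m + 1)) (g := Finset.card)
    fun σ _ => Finset.mem_range_succ_iff.2 (by simpa using Finset.card_le_univ σ)]
  refine Finset.sum_congr rfl fun k _ => ?_
  have h1 : ∀ σ ∈ ((Finset.univ : Finset (Finset (Fin m))).filter (· ∈ K.simplices)).filter
      (fun σ => σ.card = k),
      (-1 : ℤ) ^ σ.card * 2 ^ (m - σ.card) = (-1) ^ k * 2 ^ (m - k) := fun σ hσ => by
    rw [(Finset.mem_filter.1 hσ).2]
  rw [Finset.sum_congr rfl h1, Finset.sum_const, nsmul_eq_mul,
    PreAbstractSimplicialComplex.numSimplices]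
  have h2 : {σ : Finset (Fin m) | σ ∈ K.simplices ∧ (σ.card : ℤ) = (k : ℤ) - 1 + 1} =
      (((Finset.univ : Finset (Finset (Fin m))).filter (· ∈ K.simplices)).filter
        (fun σ => σ.card = k) : Finset (Finset (Fin m))) := by
    ext σ
    simp
  rw [h2, Set.ncard_coe_finset]
  ring

theorem hasEuler_realMomentAngleComplex {m : ℕ} (K : PreAbstractSimplicialComplex (Fin m)) :
    HasEuler (RealMomentAngleComplex K) (∑ k ∈ Finset.range (m + 1),
      (-1 : ℤ) ^ k * (K.numSimplices ((k : ℤ) - 1) : ℤ) * 2 ^ (m - k)) := by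
  rw [← cubeEuler_simplices]
  exact hasEuler_cubeSubset K.simplices K.isLowerSet_simplices

/-! ### The plane as a union of quadrants around a vertex -/

/-- The complex number with polar coordinates `r` and `φ`. -/
noncomputable def polarPoint (r φ : ℝ) : ℂ := r * Complex.exp (φ * Complex.I)

lemma polarPoint_eq (r φ : ℝ) :
    polarPoint r φ = (r * Real.cos φ : ℝ) + (r * Real.sin φ : ℝ) * Complex.I := by
  rw [polarPoint, Complex.exp_mul_I]
  push_cast
  ring

lemma norm_polarPoint {r : ℝ} (hr : 0 ≤ r) (φ : ℝ) : ‖polarPoint r φ‖ = r := by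
  rw [polarPoint, norm_mul, Complex.norm_exp_ofReal_mul_I, Complex.norm_real, mul_one,
    Real.norm_of_nonneg hr]

lemma polarPoint_cpow {r φ : ℝ} (hr : 0 < r) (hφ : |φ| < Real.pi) (b : ℝ) :
    polarPoint r φ ^ (b : ℂ) = polarPoint (r ^ b) (b * φ) := by
  have h := abs_lt.1 hφ
  have hne : Complex.exp (φ * Complex.I) ≠ 0 := Complex.exp_ne_zero _
  have hr' : (r : ℂ) ≠ 0 := Complex.ofReal_ne_zero.2 hr.ne'
  have hlog : Complex.log (polarPoint r φ) = Real.log r + φ * Complex.I := by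
    rw [polarPoint, Complex.log_ofReal_mul hr hne, Complex.log_exp (by simpa using h.1)
      (by simpa using h.2.le)]
  rw [Complex.cpow_def_of_ne_zero (show polarPoint r φ ≠ 0 from mul_ne_zero hr' hne), hlog,
    polarPoint,
    Real.rpow_def_of_pos hr, Complex.ofReal_exp, ← Complex.exp_add]
  congr 1
  push_cast
  ring

/-- The angle `2π / n` between consecutive edges at a vertex, where `n = k + 3`. -/
noncomputable def sectorAngle (k : ℕ) : ℝ := 2 * Real.pi / (k + 3)

/-- The exponent `n / 4` which opens a sector of angle `2π / n` to a quadrant. -/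
noncomputable def sectorExp (k : ℕ) : ℝ := (k + 3) / 4

lemma sectorAngle_pos (k : ℕ) : 0 < sectorAngle k := by
  have := Real.pi_pos
  unfold sectorAngle
  positivity

lemma sectorExp_pos (k : ℕ) : 0 < sectorExp k := by
  unfold sectorExp
  positivity

lemma sectorExp_mul_sectorAngle (k : ℕ) : sectorExp k * sectorAngle k = Real.pi / 2 := by
  unfold sectorExp sectorAngle
  field_simp
  norm_num

lemma mul_sectorAngle (k : ℕ) : (k + 3) * sectorAngle k = 2 * Real.pi := by
  unfold sectorAngle
  field_simp

lemma three_mul_sectorAngle_le (k : ℕ) : 3 * sectorAngle k ≤ 2 * Real.pi := by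
  have := mul_sectorAngle k
  have := mul_nonneg (Nat.cast_nonneg (α := ℝ) k) (sectorAngle_pos k).le
  linarith

/-- The `i`-th power of the primitive root of unity `exp (2πi / n)`. -/
noncomputable def sectorRoot {k : ℕ} (i : Fin (k + 3)) : ℂ :=
  Complex.exp (((i : ℕ) * sectorAngle k : ℝ) * Complex.I)

lemma sectorRoot_zero {k : ℕ} : sectorRoot (0 : Fin (k + 3)) = 1 := by simp [sectorRoot]

lemma sectorRoot_add {k : ℕ} (i j : Fin (k + 3)) :
    sectorRoot (i + j) = sectorRoot i * sectorRoot j := by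
  obtain ⟨q, hq⟩ : ∃ q : ℕ, (i : ℕ) + j = ((i + j : Fin (k + 3)) : ℕ) + (k + 3) * q :=
    ⟨((i : ℕ) + j) / (k + 3), by rw [Fin.val_add, Nat.mod_add_div]⟩
  have h : ((i : ℕ) : ℝ) + (j : ℕ) = ((i + j : Fin (k + 3)) : ℕ) + (k + 3) * q := by
    exact_mod_cast hq
  rw [sectorRoot, sectorRoot, sectorRoot, ← Complex.exp_add, Complex.exp_eq_exp_iff_exists_int]
  refine ⟨-(q : ℤ), ?_⟩
  have h2 : (((i + j : Fin (k + 3)) : ℕ) : ℝ) * sectorAngle k =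
      (i : ℕ) * sectorAngle k + (j : ℕ) * sectorAngle k - q * (2 * Real.pi) := by
    rw [← mul_sectorAngle k]
    linear_combination -(sectorAngle k) * h
  rw [h2]
  push_cast
  ring

lemma sectorRoot_mul_neg {k : ℕ} (i : Fin (k + 3)) : sectorRoot i * sectorRoot (-i) = 1 := by
  rw [← sectorRoot_add, add_neg_cancel, sectorRoot_zero]

lemma sectorRoot_ne_zero {k : ℕ} (i : Fin (k + 3)) : sectorRoot i ≠ 0 := Complex.exp_ne_zero _

lemma sectorRoot_neg {k : ℕ} (i : Fin (k + 3)) :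
    sectorRoot (-i) = Complex.exp ((-((i : ℕ) * sectorAngle k) : ℝ) * Complex.I) := by
  have h := sectorRoot_mul_neg i
  rw [eq_comm, Complex.ofReal_neg, neg_mul, Complex.exp_neg]
  exact inv_eq_of_mul_eq_one_right h

lemma polarPoint_mul_sectorRoot_neg {k : ℕ} (r φ : ℝ) (i : Fin (k + 3)) :
    polarPoint r φ * sectorRoot (-i) = polarPoint r (φ - (i : ℕ) * sectorAngle k) := by
  rw [sectorRoot_neg, polarPoint, polarPoint, mul_assoc, ← Complex.exp_add]
  congr 2
  push_cast
  ring

lemma val_one_fin (k : ℕ) : ((1 : Fin (k + 3)) : ℕ) = 1 := rfl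

/-- Every point of the plane lies in one of the `n` sectors of angle `2π / n`. -/
lemma exists_eq_sectorRoot_mul (k : ℕ) (w : ℂ) : ∃ (i : Fin (k + 3)) (r θ : ℝ),
    0 ≤ r ∧ 0 ≤ θ ∧ θ ≤ sectorAngle k ∧ w = sectorRoot i * polarPoint r θ := by
  obtain ⟨α, h0, h1, hw⟩ : ∃ α : ℝ, 0 ≤ α ∧ α < 2 * Real.pi ∧ w = polarPoint ‖w‖ α := by
    have hw := Complex.norm_mul_exp_arg_mul_I w
    have hp := Real.pi_pos
    rcases le_or_gt 0 w.arg with h | h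
    · exact ⟨w.arg, h, by linarith [Complex.arg_le_pi w], hw.symm⟩
    · refine ⟨w.arg + 2 * Real.pi, by linarith [Complex.neg_pi_lt_arg w], by linarith, ?_⟩
      rw [polarPoint, Complex.ofReal_add, add_mul, Complex.exp_add]
      simp [hw]
  have hs := sectorAngle_pos k
  have hq : ⌊α / sectorAngle k⌋₊ < k + 3 := by
    rw [Nat.floor_lt (by positivity), div_lt_iff₀ hs]
    push_cast
    rwa [mul_sectorAngle]
  refine ⟨⟨_, hq⟩, ‖w‖, α - ⌊α / sectorAngle k⌋₊ * sectorAngle k, norm_nonneg w, ?_, ?_, ?_⟩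
  · have := Nat.floor_le (a := α / sectorAngle k) (by positivity)
    rw [le_div_iff₀ hs] at this
    linarith
  · have := (Nat.lt_floor_add_one (α / sectorAngle k)).le
    rw [div_le_iff₀ hs] at this
    linarith
  · rw [sectorRoot, polarPoint, mul_left_comm, ← Complex.exp_add]
    nth_rw 1 [hw]
    rw [polarPoint]
    congr 2
    push_cast
    ring

/-- The coordinate of a point of the plane along the positive real axis, after the two sectors
adjacent to that axis are opened to quadrants. It vanishes outside these sectors. -/
noncomputable def sectorCoord (k : ℕ) (u : ℂ) : ℝ :=
  ‖u‖ ^ sectorExp k * Real.cos (min (sectorExp k * Real.arccos (u.re / ‖u‖)) (Real.pi / 2))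

lemma sectorCoord_nonneg (k : ℕ) (u : ℂ) : 0 ≤ sectorCoord k u := by
  have h := Real.pi_pos
  have h1 : 0 ≤ sectorExp k * Real.arccos (u.re / ‖u‖) :=
    mul_nonneg (sectorExp_pos k).le (Real.arccos_nonneg _)
  refine mul_nonneg (Real.rpow_nonneg (norm_nonneg _) _) (Real.cos_nonneg_of_mem_Icc ⟨?_, ?_⟩)
  · exact (by linarith : -(Real.pi / 2) ≤ 0).trans (le_min h1 (by positivity))
  · exact min_le_right _ _

lemma continuous_sectorCoord (k : ℕ) : Continuous (sectorCoord k) := by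
  have hr : Continuous fun u : ℂ => ‖u‖ ^ sectorExp k :=
    continuous_norm.rpow_const fun _ => Or.inr (sectorExp_pos k).le
  refine continuous_iff_continuousAt.2 fun u => ?_
  rcases eq_or_ne u 0 with rfl | hu
  · have h0 : sectorCoord k 0 = 0 := by
      simp [sectorCoord, Real.zero_rpow (sectorExp_pos k).ne']
    rw [ContinuousAt, h0]
    refine squeeze_zero (sectorCoord_nonneg k) (fun v => ?_)
      (g := fun u : ℂ => ‖u‖ ^ sectorExp k) ?_
    · exact mul_le_of_le_one_right (Real.rpow_nonneg (norm_nonneg _) _) (Real.cos_le_one _)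
    · have := hr.tendsto 0
      simpa [Real.zero_rpow (sectorExp_pos k).ne'] using this
  · have h1 : ContinuousAt (fun u : ℂ => u.re / ‖u‖) u :=
      Complex.continuous_re.continuousAt.div continuous_norm.continuousAt (norm_ne_zero_iff.2 hu)
    refine hr.continuousAt.mul (Real.continuous_cos.continuousAt.comp ?_)
    exact (continuousAt_const.mul (Real.continuous_arccos.continuousAt.comp h1)).min
      continuousAt_const

lemma sectorCoord_polarPoint {k : ℕ} {r φ : ℝ} (hr : 0 ≤ r)
    (hφ : |φ| ≤ 2 * Real.pi - sectorAngle k) :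
    sectorCoord k (polarPoint r φ) =
      r ^ sectorExp k * Real.cos (min (sectorExp k * |φ|) (Real.pi / 2)) := by
  rcases hr.eq_or_lt with rfl | hr'
  · simp [sectorCoord, polarPoint, Real.zero_rpow (sectorExp_pos k).ne']
  have hre : (polarPoint r φ).re / r = Real.cos |φ| := by
    rw [polarPoint_eq, Real.cos_abs, Complex.add_re, Complex.re_ofReal_mul, Complex.ofReal_re,
      Complex.I_re, mul_zero, add_zero, mul_div_cancel_left₀ _ hr'.ne']
  rw [sectorCoord, norm_polarPoint hr, hre]
  congr 2
  have ha := sectorExp_pos k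
  have hp := Real.pi_pos
  rcases le_or_gt |φ| Real.pi with h | h
  · rw [Real.arccos_cos (abs_nonneg _) h]
  · -- Here both angles are at least `2π / n`, so that both minima are `π / 2`.
    rw [← Real.cos_two_pi_sub, Real.arccos_cos (by linarith [sectorAngle_pos k]) (by linarith),
      min_eq_right, min_eq_right]
    · have : sectorAngle k ≤ |φ| := by linarith [three_mul_sectorAngle_le k]
      have := mul_le_mul_of_nonneg_left this ha.le
      rwa [sectorExp_mul_sectorAngle] at this
    · have : sectorAngle k ≤ 2 * Real.pi - |φ| := by linarith
      have := mul_le_mul_of_nonneg_left this ha.le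
      rwa [sectorExp_mul_sectorAngle] at this

lemma sectorCoord_rotate {k : ℕ} {r θ : ℝ} (hr : 0 ≤ r) (h0 : 0 ≤ θ) (h1 : θ ≤ sectorAngle k)
    (m : Fin (k + 3)) : sectorCoord k (polarPoint r θ * sectorRoot (-m)) =
      if m = 0 then r ^ sectorExp k * Real.cos (sectorExp k * θ)
      else if m = 1 then r ^ sectorExp k * Real.sin (sectorExp k * θ) else 0 := by
  have ha := sectorExp_pos k
  have hs := sectorAngle_pos k
  have h3 := three_mul_sectorAngle_le k
  have has := sectorExp_mul_sectorAngle k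
  have hm : ((m : ℕ) : ℝ) * sectorAngle k ≤ 2 * Real.pi - sectorAngle k := by
    rw [← mul_sectorAngle k]
    have : ((m : ℕ) : ℝ) + 1 ≤ k + 3 := by exact_mod_cast m.2
    nlinarith
  have hmn : 0 ≤ ((m : ℕ) : ℝ) * sectorAngle k := by positivity
  rw [polarPoint_mul_sectorRoot_neg, sectorCoord_polarPoint hr (abs_le.2 ⟨by linarith,
    by linarith⟩)]
  have h2 : sectorExp k * θ ≤ Real.pi / 2 := by
    rw [← has]
    exact mul_le_mul_of_nonneg_left h1 ha.le
  split_ifs with hm0 hm1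
  · subst hm0
    rw [Fin.val_zero, Nat.cast_zero, zero_mul, sub_zero, abs_of_nonneg h0, min_eq_left h2]
  · subst hm1
    rw [val_one_fin, Nat.cast_one, one_mul, abs_of_nonpos (by linarith), neg_sub, mul_sub, has,
      min_eq_left (by linarith [mul_nonneg ha.le h0]), Real.cos_pi_div_two_sub]
  · have hm2 : (2 : ℝ) ≤ (m : ℕ) := by
      have h0 : (m : ℕ) ≠ 0 := fun h => hm0 (Fin.ext h)
      have h1 : (m : ℕ) ≠ 1 := fun h => hm1 (Fin.ext h)
      exact_mod_cast (by omega : 2 ≤ (m : ℕ))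
    have h4 : 2 * sectorAngle k ≤ (m : ℕ) * sectorAngle k := mul_le_mul_of_nonneg_right hm2 hs.le
    rw [abs_of_nonpos (by linarith), min_eq_right, Real.cos_pi_div_two, mul_zero]
    rw [← has]
    exact mul_le_mul_of_nonneg_left (by linarith) ha.le

/-- The map from the plane to the cone on an `n`-gon in `ℝⁿ` which opens each of the `n` sectors
of angle `2π / n` to the quadrant spanned by two cyclically consecutive basis vectors. -/
noncomputable def planeToCone (k : ℕ) (w : ℂ) : Fin (k + 3) → ℝ :=
  fun i => sectorCoord k (w * sectorRoot (-i))

lemma continuous_planeToCone (k : ℕ) : Continuous (planeToCone k) :=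
  continuous_pi fun _ => (continuous_sectorCoord k).comp (continuous_id.mul continuous_const)

lemma planeToCone_nonneg (k : ℕ) (w : ℂ) (i : Fin (k + 3)) : 0 ≤ planeToCone k w i :=
  sectorCoord_nonneg _ _

lemma planeToCone_sector {k : ℕ} {r θ : ℝ} (hr : 0 ≤ r) (h0 : 0 ≤ θ) (h1 : θ ≤ sectorAngle k)
    (i j : Fin (k + 3)) : planeToCone k (sectorRoot i * polarPoint r θ) j =
      if j = i then r ^ sectorExp k * Real.cos (sectorExp k * θ)
      else if j = i + 1 then r ^ sectorExp k * Real.sin (sectorExp k * θ) else 0 := by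
  have : sectorRoot i * polarPoint r θ * sectorRoot (-j) =
      polarPoint r θ * sectorRoot (-(j - i)) := by
    rw [neg_sub, sub_eq_add_neg, sectorRoot_add]
    ring
  rw [planeToCone, this, sectorCoord_rotate hr h0 h1]
  simp only [sub_eq_iff_eq_add, zero_add, add_comm (1 : Fin (k + 3))]

lemma fin_add_one_ne {k : ℕ} (i : Fin (k + 3)) : i + 1 ≠ i := by
  simp [add_eq_left]

lemma fin_sub_one_ne {k : ℕ} (i : Fin (k + 3)) : i - 1 ≠ i := by
  simp [sub_eq_self]

lemma fin_sub_one_ne_add_one {k : ℕ} (i : Fin (k + 3)) : i - 1 ≠ i + 1 := by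
  intro h
  have h2 : (1 : Fin (k + 3)) + 1 = 0 := by
    rw [sub_eq_iff_eq_add, add_assoc] at h
    exact (left_eq_add.1 h)
  have := congrArg Fin.val h2
  rw [Fin.val_add, val_one_fin, Nat.mod_eq_of_lt (by omega)] at this
  simp at this

/-- The point of the half plane which describes a point of the cone near its `i`-th ray. -/
noncomputable def rayCoord {k : ℕ} (t : Fin (k + 3) → ℝ) (i : Fin (k + 3)) : ℂ :=
  t i + (t (i + 1) - t (i - 1)) * Complex.I

/-- Near the `i`-th ray the map to the cone is, up to a rotation, the power map with exponent
`n / 4`. -/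
lemma exists_rayCoord_eq {k : ℕ} {w : ℂ} {i : Fin (k + 3)} (h : 0 < planeToCone k w i) :
    ∃ r φ : ℝ, 0 < r ∧ |φ| < sectorAngle k ∧ w = sectorRoot i * polarPoint r φ ∧
      rayCoord (planeToCone k w) i = polarPoint (r ^ sectorExp k) (sectorExp k * φ) := by
  obtain ⟨j, r, θ, hr, h0, h1, rfl⟩ := exists_eq_sectorRoot_mul k w
  have hs := sectorAngle_pos k
  have ha := sectorExp_pos k
  have has := sectorExp_mul_sectorAngle k
  have hr' : r ≠ 0 := by
    rintro rfl
    rw [planeToCone_sector hr h0 h1, Real.zero_rpow ha.ne'] at h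
    simp at h
  simp only [planeToCone_sector hr h0 h1, rayCoord] at h ⊢
  by_cases hi : i = j
  · subst hi
    rw [if_pos rfl] at h
    refine ⟨r, θ, lt_of_le_of_ne hr hr'.symm, ?_, rfl, ?_⟩
    · rw [abs_of_nonneg h0]
      refine lt_of_le_of_ne h1 ?_
      rintro rfl
      rw [has, Real.cos_pi_div_two, mul_zero] at h
      exact lt_irrefl _ h
    · rw [if_pos rfl, if_neg (fin_add_one_ne i), if_pos rfl, if_neg (fin_sub_one_ne i),
        if_neg (fin_sub_one_ne_add_one i), polarPoint_eq]
      push_cast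
      ring
  · rw [if_neg hi] at h
    by_cases hi' : i = j + 1
    · subst hi'
      rw [if_pos rfl] at h
      refine ⟨r, θ - sectorAngle k, lt_of_le_of_ne hr hr'.symm, ?_, ?_, ?_⟩
      · rw [abs_of_nonpos (by linarith)]
        have : θ ≠ 0 := by
          rintro rfl
          simp at h
        have := lt_of_le_of_ne h0 this.symm
        linarith
      · have := polarPoint_mul_sectorRoot_neg r θ (1 : Fin (k + 3))
        rw [val_one_fin, Nat.cast_one, one_mul] at this
        rw [← this, sectorRoot_add]
        linear_combination (-(sectorRoot j * polarPoint r θ)) *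
          sectorRoot_mul_neg (1 : Fin (k + 3))
      · have e1 : j + 1 + 1 ≠ j := fun e => fin_sub_one_ne_add_one (j + 1) (by
          rw [add_sub_cancel_right]
          exact e.symm)
        rw [if_neg hi, if_pos rfl, if_neg e1, if_neg (fin_add_one_ne (j + 1)),
          add_sub_cancel_right, if_pos rfl, polarPoint_eq, mul_sub, has, Real.cos_sub_pi_div_two,
          Real.sin_sub_pi_div_two]
        push_cast
        ring
    · rw [if_neg hi'] at h
      exact (lt_irrefl _ h).elim

lemma polarPoint_rpow_cpow_inv {r φ a : ℝ} (hr : 0 < r) (ha : 0 < a) (hφ : |a * φ| < Real.pi) :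
    polarPoint (r ^ a) (a * φ) ^ ((a⁻¹ : ℝ) : ℂ) = polarPoint r φ := by
  rw [polarPoint_cpow (Real.rpow_pos_of_pos hr a) hφ, Real.rpow_rpow_inv hr.le ha.ne',
    inv_mul_cancel_left₀ ha.ne']

lemma abs_sectorExp_mul_lt {k : ℕ} {φ : ℝ} (h : |φ| < sectorAngle k) :
    |sectorExp k * φ| < Real.pi / 2 := by
  rw [abs_mul, abs_of_pos (sectorExp_pos k), ← sectorExp_mul_sectorAngle k]
  exact mul_lt_mul_of_pos_left h (sectorExp_pos k)

lemma sectorAngle_lt_pi (k : ℕ) : sectorAngle k < Real.pi := by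
  have := three_mul_sectorAngle_le k
  have := sectorAngle_pos k
  linarith

/-- The map to the cone is inverted near the `i`-th ray by the power map with exponent `4 / n`. -/
lemma eq_sectorRoot_mul_cpow {k : ℕ} {w : ℂ} {i : Fin (k + 3)} (h : 0 < planeToCone k w i) :
    w = sectorRoot i * rayCoord (planeToCone k w) i ^ (((sectorExp k)⁻¹ : ℝ) : ℂ) := by
  obtain ⟨r, φ, hr, hφ, hw, hz⟩ := exists_rayCoord_eq h
  have hp := Real.pi_pos
  rw [hz, polarPoint_rpow_cpow_inv hr (sectorExp_pos k)
    ((abs_sectorExp_mul_lt hφ).trans (by linarith))]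
  exact hw

lemma rayCoord_planeToCone {k : ℕ} {w : ℂ} {i : Fin (k + 3)} (h : 0 < planeToCone k w i) :
    rayCoord (planeToCone k w) i = (w * sectorRoot (-i)) ^ ((sectorExp k : ℝ) : ℂ) ∧
      w * sectorRoot (-i) ∈ Complex.slitPlane := by
  obtain ⟨r, φ, hr, hφ, hw, hz⟩ := exists_rayCoord_eq h
  have hφ' := hφ.trans (sectorAngle_lt_pi k)
  have hw' : w * sectorRoot (-i) = polarPoint r φ := by
    rw [hw]
    linear_combination polarPoint r φ * sectorRoot_mul_neg i
  rw [hw', hz, polarPoint_cpow hr hφ', Complex.mem_slitPlane_iff_arg]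
  refine ⟨rfl, ?_, ?_⟩
  · rw [polarPoint, Complex.exp_mul_I, Complex.arg_mul_cos_add_sin_mul_I hr
      ⟨(abs_lt.1 hφ').1, (abs_lt.1 hφ').2.le⟩]
    exact (abs_lt.1 hφ').2.ne
  · rw [← norm_ne_zero_iff, norm_polarPoint hr.le]
    exact hr.ne'

lemma rayCoord_re_pos {k : ℕ} {t : Fin (k + 3) → ℝ} {i : Fin (k + 3)} (h : 0 < t i) :
    0 < (rayCoord t i).re := by
  simpa [rayCoord] using h

lemma eq_zero_of_planeToCone_eq_zero {k : ℕ} {w : ℂ} (h : ∀ i, planeToCone k w i = 0) :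
    w = 0 := by
  obtain ⟨i, r, θ, hr, h0, h1, rfl⟩ := exists_eq_sectorRoot_mul k w
  have e0 := h i
  have e1 := h (i + 1)
  rw [planeToCone_sector hr h0 h1, if_pos rfl] at e0
  rw [planeToCone_sector hr h0 h1, if_neg (fin_add_one_ne i), if_pos rfl] at e1
  have e2 : r ^ sectorExp k = 0 := by
    have := Real.sin_sq_add_cos_sq (sectorExp k * θ)
    have e3 : (r ^ sectorExp k) ^ 2 * (Real.sin (sectorExp k * θ) ^ 2 +
      Real.cos (sectorExp k * θ) ^ 2) = 0 := by
      linear_combination (r ^ sectorExp k * Real.cos (sectorExp k * θ)) * e0 +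
        (r ^ sectorExp k * Real.sin (sectorExp k * θ)) * e1
    rw [this, mul_one] at e3
    exact pow_eq_zero_iff (two_ne_zero) |>.1 e3
  rw [(Real.rpow_eq_zero hr (sectorExp_pos k).ne').1 e2]
  simp [polarPoint]

lemma planeToCone_injective (k : ℕ) : Function.Injective (planeToCone k) := by
  intro w w' h
  by_cases h0 : ∀ i, planeToCone k w i = 0
  · exact (eq_zero_of_planeToCone_eq_zero h0).trans
      (eq_zero_of_planeToCone_eq_zero (w := w') (h ▸ h0)).symm
  · push Not at h0
    obtain ⟨i, hi⟩ := h0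
    have hi' := lt_of_le_of_ne (planeToCone_nonneg k w i) hi.symm
    rw [eq_sectorRoot_mul_cpow hi', h, ← eq_sectorRoot_mul_cpow (h ▸ hi')]

/-- The cone on the boundary of an `n`-gon: at most two coordinates are nonzero, and these are
cyclically adjacent. -/
def polygonCone (k : ℕ) : Set (Fin (k + 3) → ℝ) :=
  {t | (∀ i, 0 ≤ t i) ∧ ∃ i, ∀ j, j ≠ i → j ≠ i + 1 → t j = 0}

lemma planeToCone_mem (k : ℕ) (w : ℂ) : planeToCone k w ∈ polygonCone k := by
  obtain ⟨i, r, θ, hr, h0, h1, rfl⟩ := exists_eq_sectorRoot_mul k w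
  refine ⟨planeToCone_nonneg k _, i, fun j hj hj' => ?_⟩
  rw [planeToCone_sector hr h0 h1, if_neg hj, if_neg hj']

lemma exists_planeToCone_eq {k : ℕ} {t : Fin (k + 3) → ℝ} (ht : t ∈ polygonCone k) :
    ∃ w, planeToCone k w = t := by
  obtain ⟨h0, i, hi⟩ := ht
  have ha := sectorExp_pos k
  have has := sectorExp_mul_sectorAngle k
  obtain ⟨ρ, ψ, hρ, hψ0, hψ1, hc, hs⟩ : ∃ ρ ψ : ℝ, 0 ≤ ρ ∧ 0 ≤ ψ ∧ ψ ≤ Real.pi / 2 ∧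
      ρ * Real.cos ψ = t i ∧ ρ * Real.sin ψ = t (i + 1) := by
    let z : ℂ := ⟨t i, t (i + 1)⟩
    refine ⟨‖z‖, z.arg, norm_nonneg z, Complex.arg_nonneg_iff.2 (h0 _),
      (Complex.arg_le_pi_div_two_iff.2 (Or.inl (h0 _))), ?_, ?_⟩
    · exact Complex.norm_mul_cos_arg z
    · exact Complex.norm_mul_sin_arg z
  refine ⟨sectorRoot i * polarPoint (ρ ^ (sectorExp k)⁻¹) ((sectorExp k)⁻¹ * ψ), ?_⟩
  funext j
  rw [planeToCone_sector (Real.rpow_nonneg hρ _) (by positivity), Real.rpow_inv_rpow hρ ha.ne',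
    mul_inv_cancel_left₀ ha.ne', hc, hs]
  · split_ifs with h1 h2
    · rw [h1]
    · rw [h2]
    · exact (hi j h1 h2).symm
  · rw [← div_eq_inv_mul, div_le_iff₀ ha, mul_comm, has]
    exact hψ1

lemma norm_rpow_le_planeToCone (k : ℕ) (w : ℂ) :
    ‖w‖ ^ sectorExp k ≤ 3 * ‖planeToCone k w‖ := by
  by_cases h0 : ∀ i, planeToCone k w i = 0
  · rw [eq_zero_of_planeToCone_eq_zero h0, norm_zero, Real.zero_rpow (sectorExp_pos k).ne']
    positivity
  · push Not at h0
    obtain ⟨i, hi⟩ := h0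
    have hi' := lt_of_le_of_ne (planeToCone_nonneg k w i) hi.symm
    obtain ⟨r, φ, hr, hφ, hw, hz⟩ := exists_rayCoord_eq hi'
    have hn : ‖w‖ = r := by
      rw [hw, norm_mul, norm_polarPoint hr.le, sectorRoot, Complex.norm_exp_ofReal_mul_I, one_mul]
    rw [hn, ← norm_polarPoint (Real.rpow_nonneg hr.le _) (sectorExp k * φ), ← hz, rayCoord]
    have hb : ∀ j, ‖((planeToCone k w j : ℝ) : ℂ)‖ ≤ ‖planeToCone k w‖ := fun j => by
      rw [Complex.norm_real]
      exact norm_le_pi_norm _ j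
    refine (norm_add_le _ _).trans ?_
    rw [norm_mul, Complex.norm_I, mul_one]
    linarith [hb i, hb (i + 1), hb (i - 1), norm_sub_le ((planeToCone k w (i + 1) : ℝ) : ℂ)
      ((planeToCone k w (i - 1) : ℝ) : ℂ)]

lemma isClosedEmbedding_planeToCone (k : ℕ) : Topology.IsClosedEmbedding (planeToCone k) := by
  refine .of_continuous_injective_isClosedMap (continuous_planeToCone k)
    (planeToCone_injective k) (IsProperMap.isClosedMap ?_)
  refine isProperMap_iff_tendsto_cocompact.2 ⟨continuous_planeToCone k, ?_⟩
  rw [← Metric.cobounded_eq_cocompact, ← Metric.cobounded_eq_cocompact,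
    ← tendsto_norm_atTop_iff_cobounded]
  have h1 : Filter.Tendsto (fun w : ℂ => ‖w‖ ^ sectorExp k / 3)
      (Bornology.cobounded ℂ) Filter.atTop :=
    ((tendsto_rpow_atTop (sectorExp_pos k)).comp tendsto_norm_cobounded_atTop).atTop_div_const
      (by norm_num)
  refine Filter.tendsto_atTop_mono (fun w => ?_) h1
  linarith [norm_rpow_le_planeToCone k w]

/-- The inverse of `planeToCone`. Only its values on the cone on the boundary of an `n`-gon are
meaningful. -/
noncomputable def coneToPlane (k : ℕ) : (Fin (k + 3) → ℝ) → ℂ := Function.invFun (planeToCone k)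

lemma coneToPlane_planeToCone (k : ℕ) (w : ℂ) : coneToPlane k (planeToCone k w) = w :=
  Function.leftInverse_invFun (planeToCone_injective k) w

lemma planeToCone_coneToPlane {k : ℕ} {t : Fin (k + 3) → ℝ} (ht : t ∈ polygonCone k) :
    planeToCone k (coneToPlane k t) = t :=
  Function.invFun_eq (exists_planeToCone_eq ht)

lemma continuousOn_coneToPlane (k : ℕ) : ContinuousOn (coneToPlane k) (polygonCone k) :=
  (isClosedEmbedding_planeToCone k).isInducing.continuousOn_iff.2
    (continuousOn_id.congr fun _ ht => planeToCone_coneToPlane ht)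

/-! ### Orientation characters of smooth maps of the plane -/

/-- The map `f` is smooth at `z`, and its Jacobian determinant there is nonzero with sign `ε`. -/
def OrientedAt (ε : ℤˣ) (f : ℂ → ℂ) (z : ℂ) : Prop :=
  ContDiffAt ℝ ∞ f z ∧ 0 < ((ε : ℤ) : ℝ) * (fderiv ℝ f z).det

lemma OrientedAt.congr {ε : ℤˣ} {f g : ℂ → ℂ} {z : ℂ} (h : OrientedAt ε f z)
    (hfg : g =ᶠ[nhds z] f) : OrientedAt ε g z :=
  ⟨h.1.congr_of_eventuallyEq hfg, by rw [hfg.fderiv_eq]; exact h.2⟩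

lemma OrientedAt.comp {ε δ : ℤˣ} {f g : ℂ → ℂ} {z : ℂ} (hf : OrientedAt ε f (g z))
    (hg : OrientedAt δ g z) : OrientedAt (ε * δ) (f ∘ g) z := by
  refine ⟨hf.1.comp z hg.1, ?_⟩
  rw [fderiv_comp z (hf.1.differentiableAt (by simp)) (hg.1.differentiableAt (by simp))]
  have : ((fderiv ℝ f (g z)).comp (fderiv ℝ g z)).det =
      (fderiv ℝ f (g z)).det * (fderiv ℝ g z).det := LinearMap.det_comp _ _
  rw [this]
  push_cast
  have := mul_pos hf.2 hg.2
  linarith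

lemma orientedAt_one_of_contDiffAt {f : ℂ → ℂ} {z : ℂ} (hf : ContDiffAt ℂ ∞ f z)
    (h : deriv f z ≠ 0) : OrientedAt 1 f z := by
  refine ⟨hf.restrict_scalars ℝ, ?_⟩
  have h1 : HasFDerivAt f _ z := (hf.differentiableAt (by simp)).hasDerivAt.hasFDerivAt
  rw [(h1.restrictScalars ℝ).fderiv]
  have h2 : ((ContinuousLinearMap.toSpanSingleton ℂ (deriv f z)).restrictScalars ℝ).det =
      Algebra.norm ℝ (deriv f z) := by
    rw [Algebra.norm_apply]
    refine congrArg LinearMap.det (LinearMap.ext fun w => ?_)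
    simp [mul_comm]
  rw [h2, Algebra.norm_complex_apply]
  simpa using Complex.normSq_pos.2 h

lemma orientedAt_conj (z : ℂ) : OrientedAt (-1) (starRingEnd ℂ) z := by
  refine ⟨Complex.conjCLE.contDiff.contDiffAt, ?_⟩
  have h : fderiv ℝ (starRingEnd ℂ) z = (Complex.conjCLE : ℂ →L[ℝ] ℂ) :=
    (Complex.conjCLE.hasFDerivAt (x := z)).fderiv
  have h2 : ((Complex.conjCLE : ℂ →L[ℝ] ℂ)).det = -1 := Complex.det_conjAe
  rw [h, h2]
  simp

lemma orientedAt_id (z : ℂ) : OrientedAt 1 id z :=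
  orientedAt_one_of_contDiffAt contDiffAt_id (by simp)

lemma orientedAt_mul_const {a : ℂ} (ha : a ≠ 0) (z : ℂ) : OrientedAt 1 (fun w => w * a) z := by
  refine orientedAt_one_of_contDiffAt (contDiffAt_id.mul contDiffAt_const) ?_
  rw [(hasDerivAt_mul_const a).deriv]
  exact ha

lemma orientedAt_const_sub (a z : ℂ) : OrientedAt 1 (fun w => a - w) z := by
  refine orientedAt_one_of_contDiffAt (contDiffAt_const.sub contDiffAt_id) ?_
  rw [((hasDerivAt_id' z).const_sub a).deriv]
  simp

lemma orientedAt_cpow {b : ℝ} (hb : b ≠ 0) {z : ℂ} (hz : z ∈ Complex.slitPlane) :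
    OrientedAt 1 (fun w => w ^ (b : ℂ)) z := by
  have hb' : (b : ℂ) ≠ 0 := Complex.ofReal_ne_zero.2 hb
  refine orientedAt_one_of_contDiffAt ?_ ?_
  · exact (analyticAt_id.cpow analyticAt_const hz).contDiffAt
  · rw [((hasDerivAt_id' z).cpow_const hz).deriv]
    have : z ≠ 0 := Complex.slitPlane_ne_zero hz
    simp [hb', this]

/-- A map of the plane which is expressed by `A` in the coordinate along a ray has the orientation
character of `A`. -/
lemma orientedAt_ray {k : ℕ} {i : Fin (k + 3)} {ε : ℤˣ} {A : ℂ → ℂ} {w : ℂ}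
    (hw : w * sectorRoot (-i) ∈ Complex.slitPlane)
    (hA : OrientedAt ε A ((w * sectorRoot (-i)) ^ (sectorExp k : ℂ)))
    (hA' : A ((w * sectorRoot (-i)) ^ (sectorExp k : ℂ)) ∈ Complex.slitPlane) :
    OrientedAt ε (fun w => sectorRoot i *
      A ((w * sectorRoot (-i)) ^ (sectorExp k : ℂ)) ^ (((sectorExp k)⁻¹ : ℝ) : ℂ)) w := by
  have h1 := orientedAt_mul_const (sectorRoot_ne_zero (-i)) w
  have h2 := OrientedAt.comp (g := fun w => w * sectorRoot (-i))
    (orientedAt_cpow (sectorExp_pos k).ne' hw) h1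
  have h3 := OrientedAt.comp (g := (fun w => w ^ (sectorExp k : ℂ)) ∘
    fun w => w * sectorRoot (-i)) hA h2
  have h4 := OrientedAt.comp (g := A ∘ (fun w => w ^ (sectorExp k : ℂ)) ∘
    fun w => w * sectorRoot (-i))
    (orientedAt_cpow (inv_ne_zero (sectorExp_pos k).ne') hA') h3
  have h5 := (orientedAt_mul_const (sectorRoot_ne_zero i) _).comp h4
  simp only [mul_one, one_mul] at h5
  exact h5.congr (.of_forall fun w => mul_comm _ _)

/-- The isometry of the plane which reverses the orientation if `ε = -1`. -/
noncomputable def orientIso (ε : ℤˣ) : ℂ ≃ₗᵢ[ℝ] ℂ :=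
  if ε = 1 then .refl ℝ ℂ else Complex.conjLIE

lemma orientedAt_orientIso (ε : ℤˣ) (z : ℂ) : OrientedAt ε (orientIso ε) z := by
  rcases Int.units_eq_one_or ε with rfl | rfl
  · rw [orientIso, if_pos rfl]
    exact orientedAt_id z
  · rw [orientIso, if_neg (by decide)]
    exact orientedAt_conj z

lemma orientedAt_orientIso_symm (ε : ℤˣ) (z : ℂ) : OrientedAt ε (orientIso ε).symm z := by
  rcases Int.units_eq_one_or ε with rfl | rfl
  · rw [orientIso, if_pos rfl]
    exact orientedAt_id z
  · rw [orientIso, if_neg (by decide)]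
    exact orientedAt_conj z

/-- The identification of `ℂ` with the Euclidean plane. -/
noncomputable def planeIso : ℂ ≃ₗᵢ[ℝ] EuclideanSpace ℝ (Fin 2) := Complex.orthonormalBasisOneI.repr

lemma OrientedAt.planeIso_conj {f : ℂ → ℂ} {x : EuclideanSpace ℝ (Fin 2)}
    (h : OrientedAt 1 f (planeIso.symm x)) :
    ContDiffAt ℝ ∞ (planeIso ∘ f ∘ planeIso.symm) x ∧
      0 < (fderiv ℝ (planeIso ∘ f ∘ planeIso.symm) x).det := by
  refine ⟨planeIso.contDiff.contDiffAt.comp x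
    (h.1.comp x planeIso.symm.contDiff.contDiffAt), ?_⟩
  have h1 : HasFDerivAt f _ (planeIso.symm x) := (h.1.differentiableAt (by simp)).hasFDerivAt
  have h2 := planeIso.symm.toContinuousLinearEquiv.hasFDerivAt (x := x)
  have h3 := planeIso.toContinuousLinearEquiv.hasFDerivAt (x := f (planeIso.symm x))
  have h5 : HasFDerivAt (planeIso ∘ f ∘ planeIso.symm) _ x := h3.comp x (h1.comp x h2)
  rw [h5.fderiv]
  have h4 := LinearMap.det_conj ((fderiv ℝ f (planeIso.symm x) : ℂ →L[ℝ] ℂ) : ℂ →ₗ[ℝ] ℂ)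
    planeIso.toLinearEquiv
  refine lt_of_lt_of_eq h.2 ?_
  rw [Units.val_one, Int.cast_one, one_mul]
  exact h4.symm

/-! ### The surface of a polygon -/

lemma mem_polygonMomentAngle {k : ℕ} {x : Fin (k + 3) → OneDisc} :
    x ∈ polyhedralProduct (polygonBoundary (k + 3)) (fun _ => OneDisc) (fun _ => zeroSphere) ↔
      ∃ i, ∀ j, j ≠ i → j ≠ i + 1 → x j ∈ zeroSphere := by
  simp only [polyhedralProduct, Set.mem_iUnion, exists_prop, Set.mem_ofPred_eq]
  constructor
  · rintro ⟨σ, rfl | ⟨i, rfl⟩ | ⟨i, j, hij, rfl⟩, h⟩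
    · exact ⟨0, fun j _ _ => h j (by simp)⟩
    · exact ⟨i, fun j hj _ => h j (by simpa using hj)⟩
    · rcases SimpleGraph.cycleGraph_adj.1 hij with e | e
      · obtain rfl := sub_eq_iff_eq_add'.1 e
        exact ⟨j, fun l hl hl' => h l (by simp [hl, hl'])⟩
      · obtain rfl := sub_eq_iff_eq_add'.1 e
        exact ⟨i, fun l hl hl' => h l (by simp [hl, hl'])⟩
  · rintro ⟨i, h⟩
    refine ⟨{i, i + 1}, Or.inr (Or.inr ⟨i, i + 1, SimpleGraph.cycleGraph_adj.2 (Or.inr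
      (add_sub_cancel_left _ _)), rfl⟩), fun j hj => ?_⟩
    simp only [Finset.mem_insert, Finset.mem_singleton, not_or] at hj
    exact h j hj.1 hj.2

/-- The surface attached to the `n`-gon, where `n = k + 3`. -/
abbrev PolygonSurface (k : ℕ) : Type := RealMomentAngleComplex (polygonBoundary (k + 3))

lemma continuous_polygonSurface_coord {k : ℕ} (i : Fin (k + 3)) :
    Continuous fun x : PolygonSurface k => (x.1 i : ℝ) :=
  continuous_subtype_val.comp ((continuous_apply i).comp continuous_subtype_val)

lemma units_sq_real (u : ℤˣ) : ((u : ℤ) : ℝ) * ((u : ℤ) : ℝ) = 1 := by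
  rcases Int.units_eq_one_or u with rfl | rfl <;> simp

lemma units_mul_mem_Icc (u : ℤˣ) (t : OneDisc) : ((u : ℤ) : ℝ) * t ∈ Set.Icc (-1 : ℝ) 1 := by
  obtain ⟨t, h1, h2⟩ := t
  rcases Int.units_eq_one_or u with rfl | rfl
  · simpa using ⟨h1, h2⟩
  · simpa using ⟨h2, by linarith⟩

/-- The open star of the vertex `v` of the surface. -/
def vertexStar {k : ℕ} (v : Fin (k + 3) → ℤˣ) : Set (PolygonSurface k) :=
  {x | ∀ i, (-1 : ℝ) < ((v i : ℤ) : ℝ) * x.1 i}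

/-- The position of a point of the surface relative to the vertex `v`. -/
def coneCoord {k : ℕ} (v : Fin (k + 3) → ℤˣ) (x : PolygonSurface k) : Fin (k + 3) → ℝ :=
  fun i => 1 - ((v i : ℤ) : ℝ) * x.1 i

lemma coneCoord_mem {k : ℕ} {v : Fin (k + 3) → ℤˣ} {x : PolygonSurface k}
    (hx : x ∈ vertexStar v) : coneCoord v x ∈ polygonCone k := by
  obtain ⟨i, hi⟩ := mem_polygonMomentAngle.1 x.2
  refine ⟨fun j => sub_nonneg.2 (units_mul_mem_Icc _ _).2, i, fun j hj hj' => ?_⟩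
  have h1 : (x.1 j : ℝ) * x.1 j = 1 := by rcases hi j hj hj' with h | h <;> rw [h] <;> norm_num
  have h2 : coneCoord v x j * (1 + ((v j : ℤ) : ℝ) * x.1 j) = 0 := by
    rw [coneCoord]
    linear_combination (-(x.1 j : ℝ) * x.1 j) * units_sq_real (v j) - h1
  exact (mul_eq_zero.1 h2).resolve_right (by linarith [hx j])

/-- The point of the surface whose position relative to the vertex `v` is given by a point of the
plane. The truncation of the coordinates makes the value meaningful everywhere. -/
noncomputable def starPoint {k : ℕ} (v : Fin (k + 3) → ℤˣ) (w : ℂ) : PolygonSurface k :=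
  ⟨fun i => ⟨((v i : ℤ) : ℝ) * (1 - min (planeToCone k w i) 2),
    units_mul_mem_Icc (v i) ⟨1 - min (planeToCone k w i) 2,
      by linarith [min_le_right (planeToCone k w i) 2],
      by linarith [le_min (planeToCone_nonneg k w i) zero_le_two]⟩⟩, by
    obtain ⟨i, hi⟩ := (planeToCone_mem k w).2
    refine mem_polygonMomentAngle.2 ⟨i, fun j hj hj' => ?_⟩
    rcases Int.units_eq_one_or (v j) with h | h
    · exact Or.inr (by simp [h, hi j hj hj'])
    · exact Or.inl (by simp [h, hi j hj hj'])⟩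

/-- The part of the plane which corresponds to the open star of a vertex. -/
def planeStar (k : ℕ) : Set ℂ := {w | ∀ i, planeToCone k w i < 2}

lemma starPoint_coord {k : ℕ} (v : Fin (k + 3) → ℤˣ) {w : ℂ} (hw : w ∈ planeStar k)
    (i : Fin (k + 3)) :
    ((starPoint v w).1 i : ℝ) = ((v i : ℤ) : ℝ) * (1 - planeToCone k w i) := by
  change ((v i : ℤ) : ℝ) * (1 - min (planeToCone k w i) 2) = _
  rw [min_eq_left (hw i).le]

lemma coneCoord_starPoint {k : ℕ} (v : Fin (k + 3) → ℤˣ) {w : ℂ} (hw : w ∈ planeStar k) :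
    coneCoord v (starPoint v w) = planeToCone k w := by
  funext i
  rw [coneCoord, starPoint_coord v hw]
  linear_combination (planeToCone k w i - 1) * units_sq_real (v i)

lemma continuous_starPoint {k : ℕ} (v : Fin (k + 3) → ℤˣ) : Continuous (starPoint v) := by
  refine Continuous.subtype_mk (continuous_pi fun i => Continuous.subtype_mk ?_ _) _
  exact continuous_const.mul (continuous_const.sub
    (((continuous_apply i).comp (continuous_planeToCone k)).min continuous_const))

lemma continuous_coneCoord {k : ℕ} (v : Fin (k + 3) → ℤˣ) : Continuous (coneCoord v) :=
  continuous_pi fun i => continuous_const.sub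
    (continuous_const.mul (continuous_polygonSurface_coord i))

/-- The chart of the surface on the open star of a vertex. -/
noncomputable def starChart {k : ℕ} (v : Fin (k + 3) → ℤˣ) :
    OpenPartialHomeomorph (PolygonSurface k) ℂ where
  toFun x := coneToPlane k (coneCoord v x)
  invFun := starPoint v
  source := vertexStar v
  target := planeStar k
  map_source' x hx i := by
    rw [planeToCone_coneToPlane (coneCoord_mem hx), coneCoord]
    linarith [hx i]
  map_target' w hw i := by
    rw [starPoint_coord v hw, ← mul_assoc, units_sq_real]
    linarith [hw i]
  left_inv' x hx := by
    have h := planeToCone_coneToPlane (coneCoord_mem hx)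
    have hw : coneToPlane k (coneCoord v x) ∈ planeStar k := fun i => by
      rw [h, coneCoord]
      linarith [hx i]
    refine Subtype.ext (funext fun i => Subtype.ext ?_)
    rw [starPoint_coord v hw, h, coneCoord]
    linear_combination (x.1 i : ℝ) * units_sq_real (v i)
  right_inv' w hw := by
    rw [coneCoord_starPoint v hw, coneToPlane_planeToCone]
  open_source := by
    have : vertexStar v = ⋂ i, {x | (-1 : ℝ) < ((v i : ℤ) : ℝ) * x.1 i} := by
      ext x
      simp [vertexStar]
    rw [this]
    exact isOpen_iInter_of_finite fun i =>
      isOpen_lt continuous_const (continuous_const.mul (continuous_polygonSurface_coord i))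
  open_target := by
    have : planeStar k = ⋂ i, {w | planeToCone k w i < 2} := by
      ext x
      simp [planeStar]
    rw [this]
    exact isOpen_iInter_of_finite fun i =>
      isOpen_lt ((continuous_apply i).comp (continuous_planeToCone k)) continuous_const
  continuousOn_toFun := (continuousOn_coneToPlane k).comp (continuous_coneCoord v).continuousOn
    fun _ hx => coneCoord_mem hx
  continuousOn_invFun := (continuous_starPoint v).continuousOn

lemma rayCoord_of_flip {k : ℕ} {s t : Fin (k + 3) → ℝ} {i : Fin (k + 3)} (h : s i = 2 - t i)
    (h' : ∀ j, j ≠ i → s j = t j) : rayCoord s i = 2 - starRingEnd ℂ (rayCoord t i) := by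
  rw [rayCoord, rayCoord, h, h' _ (fin_add_one_ne i), h' _ (fin_sub_one_ne i)]
  simp only [map_add, map_mul, map_sub, Complex.conj_ofReal, Complex.conj_I]
  push_cast
  ring

lemma rayCoord_of_flip_two {k : ℕ} {s t : Fin (k + 3) → ℝ} {i : Fin (k + 3)} (h : s i = 2 - t i)
    (h1 : s (i + 1) = 2 - t (i + 1)) (hs : s (i - 1) = 0) (ht : t (i - 1) = 0) :
    rayCoord s i = (2 + 2 * Complex.I) - rayCoord t i := by
  rw [rayCoord, rayCoord, h, h1, hs, ht]
  push_cast
  ring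

lemma eq_zero_of_mem_polygonCone {k : ℕ} {t : Fin (k + 3) → ℝ} (ht : t ∈ polygonCone k)
    {i : Fin (k + 3)} (h : t i ≠ 0) (h1 : t (i + 1) ≠ 0) : t (i - 1) = 0 := by
  obtain ⟨-, m, hm⟩ := ht
  have a1 : i = m ∨ i = m + 1 := by
    by_contra! hc
    exact h (hm _ hc.1 hc.2)
  have a2 : i + 1 = m ∨ i + 1 = m + 1 := by
    by_contra! hc
    exact h1 (hm _ hc.1 hc.2)
  have hi := fin_add_one_ne i
  have hi' := fin_sub_one_ne i
  have hi2 := fin_sub_one_ne_add_one i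
  rcases a1 with rfl | a1 <;> rcases a2 with a2 | a2
  · exact (hi a2).elim
  · exact hm _ hi' hi2
  · exact hm _ (a2 ▸ hi2) (a1 ▸ hi')
  · exact (hi (a2.trans a1.symm)).elim

/-- The coordinate change between the charts at two vertices is smooth, and the sign of its
Jacobian determinant is the product of all coordinates of the two vertices. -/
lemma orientedAt_starChart {k : ℕ} (v v' : Fin (k + 3) → ℤˣ) {w : ℂ}
    (hw : w ∈ ((starChart v).symm.trans (starChart v')).source) :
    OrientedAt ((∏ i, v' i) * ∏ i, v i) ((starChart v).symm.trans (starChart v')) w := by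
  set T := (starChart v).symm.trans (starChart v') with hT
  have hsrc : ∀ {u}, u ∈ T.source → u ∈ planeStar k ∧ starPoint v u ∈ vertexStar v' := fun {u} hu =>
    (by simpa [hT, OpenPartialHomeomorph.trans_source] using hu :
      u ∈ (starChart v).target ∧ (starChart v).symm u ∈ (starChart v').source)
  have hS : T.source ∈ nhds w := T.open_source.mem_nhds hw
  have hτ : ∀ {u}, u ∈ T.source → ∀ j, planeToCone k (T u) j =
      1 - (((v' j * v j : ℤˣ) : ℤ) : ℝ) * (1 - planeToCone k u j) := fun {u} hu j => by
    obtain ⟨h1, h2⟩ := hsrc hu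
    have h3 : planeToCone k (T u) = coneCoord v' (starPoint v u) :=
      planeToCone_coneToPlane (coneCoord_mem h2)
    rw [h3, coneCoord, starPoint_coord v h1]
    push_cast
    ring
  rw [← Finset.prod_mul_distrib]
  have hsame : ∀ {j}, v' j * v j = 1 → ∀ {u}, u ∈ T.source →
      planeToCone k (T u) j = planeToCone k u j := fun {j} hj {u} hu => by
    rw [hτ hu, hj]
    simp
  have hflip : ∀ {j}, v' j * v j = -1 → ∀ {u}, u ∈ T.source →
      planeToCone k (T u) j = 2 - planeToCone k u j ∧ 0 < planeToCone k u j ∧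
        0 < planeToCone k (T u) j := fun {j} hj {u} hu => by
    obtain ⟨h1, h2⟩ := hsrc hu
    have h3 : planeToCone k (T u) j = 2 - planeToCone k u j := by
      rw [hτ hu, hj]
      push_cast
      ring
    have h4 : planeToCone k (T u) j < 2 := by
      have h5 : planeToCone k (T u) = coneCoord v' (starPoint v u) :=
        planeToCone_coneToPlane (coneCoord_mem h2)
      rw [h5, coneCoord]
      linarith [h2 j]
    exact ⟨h3, by linarith, by linarith [h1 j]⟩
  -- If the vertices differ in the coordinate `i`, then the common points of the two stars lie on
  -- the open half planes along the `i`-th rays, and `A` is the coordinate change between these.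
  have key : ∀ (i : Fin (k + 3)) (ε : ℤˣ) (A : ℂ → ℂ), v' i * v i = -1 →
      (∀ z, OrientedAt ε A z) → (∀ u ∈ T.source, rayCoord (planeToCone k (T u)) i =
        A (rayCoord (planeToCone k u) i)) → OrientedAt ε T w := by
    intro i ε A hi hA hray
    obtain ⟨e1, e2⟩ := rayCoord_planeToCone (hflip hi hw).2.1
    refine (orientedAt_ray e2 (hA _) ?_).congr (Filter.eventually_of_mem hS fun u hu => ?_)
    · rw [← e1, ← hray w hw]
      exact Or.inl (rayCoord_re_pos (hflip hi hw).2.2)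
    · beta_reduce
      rw [← (rayCoord_planeToCone (hflip hi hu).2.1).1, ← hray u hu]
      exact eq_sectorRoot_mul_cpow (hflip hi hu).2.2
  have key1 : ∀ i, v' i * v i = -1 → (∀ j, j ≠ i → v' j * v j = 1) →
      OrientedAt (∏ j, v' j * v j) T w := by
    intro i hi hj
    rw [Finset.prod_eq_single i (fun j _ h => hj j h) (by simp), hi]
    refine key i _ (fun z => 2 - starRingEnd ℂ z) hi (fun z => ?_) fun u hu =>
      rayCoord_of_flip (hflip hi hu).1 fun j h => hsame (hj j h) hu
    have := (orientedAt_const_sub 2 _).comp (orientedAt_conj z)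
    rwa [one_mul] at this
  obtain ⟨m, hm⟩ := (planeToCone_mem k w).2
  have hother : ∀ j, j ≠ m → j ≠ m + 1 → v' j * v j = 1 := fun j h h' =>
    (Int.units_eq_one_or _).resolve_right fun e => (hflip e hw).2.1.ne' (hm j h h')
  rcases Int.units_eq_one_or (v' m * v m) with h0 | h0 <;>
    rcases Int.units_eq_one_or (v' (m + 1) * v (m + 1)) with h1 | h1
  · have hall : ∀ j, v' j * v j = 1 := fun j => by
      by_cases h : j = m
      · rwa [h]
      · by_cases h' : j = m + 1
        · rwa [h']
        · exact hother j h h'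
    rw [Finset.prod_eq_one fun j _ => hall j]
    exact (orientedAt_id w).congr (Filter.eventually_of_mem hS fun u hu =>
      planeToCone_injective k (funext fun j => hsame (hall j) hu))
  · refine key1 (m + 1) h1 fun j h => ?_
    by_cases h' : j = m
    · rwa [h']
    · exact hother j h' h
  · refine key1 m h0 fun j h => ?_
    by_cases h' : j = m + 1
    · rwa [h']
    · exact hother j h h'
  · rw [Finset.prod_eq_mul m (m + 1) (fin_add_one_ne m).symm (fun j _ h => hother j h.1 h.2)
      (by simp) (by simp), h0, h1]
    refine key m _ (fun z => (2 + 2 * Complex.I) - z) h0 (fun z => ?_) fun u hu =>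
      rayCoord_of_flip_two (hflip h0 hu).1 (hflip h1 hu).1
        (eq_zero_of_mem_polygonCone (planeToCone_mem k _) (hflip h0 hu).2.2.ne'
          (hflip h1 hu).2.2.ne')
        (eq_zero_of_mem_polygonCone (planeToCone_mem k _) (hflip h0 hu).2.1.ne'
          (hflip h1 hu).2.1.ne')
    simpa using orientedAt_const_sub (2 + 2 * Complex.I) z

/-- The chart at a vertex, reflected if the vertex has an odd number of negative coordinates. -/
noncomputable def orientedChart {k : ℕ} (v : Fin (k + 3) → ℤˣ) :
    OpenPartialHomeomorph (PolygonSurface k) (EuclideanSpace ℝ (Fin 2)) :=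
  ((starChart v).transHomeomorph (orientIso (∏ i, v i)).toHomeomorph).transHomeomorph
    planeIso.toHomeomorph

lemma orientedChart_transition {k : ℕ} (v v' : Fin (k + 3) → ℤˣ) {x : EuclideanSpace ℝ (Fin 2)}
    (hx : x ∈ ((orientedChart v).symm.trans (orientedChart v')).source) :
    ContDiffAt ℝ ∞ ((orientedChart v).symm.trans (orientedChart v')) x ∧
      0 < (fderiv ℝ ((orientedChart v).symm.trans (orientedChart v')) x).det := by
  set c := orientIso (∏ i, v i) with hc
  set c' := orientIso (∏ i, v' i) with hc'
  have h1 : c.symm (planeIso.symm x) ∈ ((starChart v).symm.trans (starChart v')).source := by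
    rw [OpenPartialHomeomorph.trans_source] at hx ⊢
    exact hx
  have h2 := (orientedAt_starChart v v' h1).comp (orientedAt_orientIso_symm (∏ i, v i) _)
  have h3 := (orientedAt_orientIso (∏ i, v' i) _).comp h2
  have h4 : (∏ i, v' i) * ((∏ i, v' i) * (∏ i, v i) * ∏ i, v i) = 1 := by
    rw [mul_assoc (∏ i, v' i), Int.units_mul_self, mul_one, Int.units_mul_self]
  rw [h4] at h3
  exact h3.planeIso_conj

lemma exists_mem_vertexStar {k : ℕ} (x : PolygonSurface k) :
    ∃ v : Fin (k + 3) → ℤˣ, x ∈ vertexStar v := by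
  refine ⟨fun i => if (0 : ℝ) ≤ x.1 i then 1 else -1, fun i => ?_⟩
  by_cases h : (0 : ℝ) ≤ x.1 i
  · simp only [if_pos h, Units.val_one, Int.cast_one]
    linarith
  · simp only [if_neg h, Units.val_neg, Units.val_one, Int.cast_neg, Int.cast_one]
    linarith

/-- The smooth structure of the surface of a polygon. -/
noncomputable abbrev polygonSurfaceCharts (k : ℕ) :
    ChartedSpace (EuclideanSpace ℝ (Fin 2)) (PolygonSurface k) where
  atlas := Set.range orientedChart
  chartAt x := orientedChart (exists_mem_vertexStar x).choose
  mem_chart_source x := (exists_mem_vertexStar x).choose_spec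
  chart_mem_atlas _ := Set.mem_range_self _

lemma compactSpace_polygonSurface (k : ℕ) : CompactSpace (PolygonSurface k) := by
  refine isCompact_iff_compactSpace.1 (IsClosed.isCompact ?_)
  have h : polyhedralProduct (polygonBoundary (k + 3)) (fun _ => OneDisc) (fun _ => zeroSphere) =
      ⋃ i : Fin (k + 3), ⋂ j, {x | j ≠ i → j ≠ i + 1 → x j ∈ zeroSphere} := by
    ext x
    simp only [mem_polygonMomentAngle, Set.mem_iUnion, Set.mem_iInter, Set.mem_ofPred_eq]
  have h0 : IsClosed zeroSphere := by
    have : zeroSphere = ((↑) : OneDisc → ℝ) ⁻¹' {-1, 1} := by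
      ext x
      simp [zeroSphere]
    rw [this]
    exact (Set.toFinite _).isClosed.preimage continuous_subtype_val
  rw [h]
  refine isClosed_iUnion_of_finite fun i => isClosed_iInter fun j => ?_
  by_cases hj : j ≠ i ∧ j ≠ i + 1
  · have h1 := h0.preimage (continuous_apply (A := fun _ : Fin (k + 3) => OneDisc) j)
    convert h1 using 1
    ext x
    simp [hj.1, hj.2]
  · have : {x : Fin (k + 3) → OneDisc | j ≠ i → j ≠ i + 1 → x j ∈ zeroSphere} = Set.univ :=
      Set.eq_univ_of_forall fun x h1 h2 => (hj ⟨h1, h2⟩).elim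
    rw [this]
    exact isClosed_univ

/-- Two points which are the ends of a segment parallel to a coordinate axis lie in the same
component. -/
lemma connectedComponent_update {k : ℕ} {x : Fin (k + 3) → OneDisc} {i : Fin (k + 3)}
    (h : ∀ s, Function.update x i s ∈ polyhedralProduct (polygonBoundary (k + 3))
      (fun _ => OneDisc) (fun _ => zeroSphere)) (s t : OneDisc) :
    connectedComponent (⟨_, h s⟩ : PolygonSurface k) = connectedComponent ⟨_, h t⟩ := by
  have : PreconnectedSpace OneDisc := Subtype.preconnectedSpace isPreconnected_Icc
  have hc : Continuous fun s => (⟨_, h s⟩ : PolygonSurface k) :=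
    Continuous.subtype_mk (f := fun s => Function.update x i s)
      (continuous_const.update i continuous_id) _
  exact connectedComponent_eq ((isPreconnected_range hc).subset_connectedComponent
    (Set.mem_range_self s) (Set.mem_range_self t))

lemma connectedSpace_polygonSurface (k : ℕ) : ConnectedSpace (PolygonSurface k) := by
  classical
  let o : OneDisc := ⟨1, by norm_num⟩
  have ho : o ∈ zeroSphere := Or.inr rfl
  have hvert : ∀ x : Fin (k + 3) → OneDisc, (∃ i, ∀ j, j ≠ i → x j ∈ zeroSphere) →
      x ∈ polyhedralProduct (polygonBoundary (k + 3)) (fun _ => OneDisc) (fun _ => zeroSphere) :=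
    fun x ⟨i, hi⟩ => mem_polygonMomentAngle.2 ⟨i, fun j hj _ => hi j hj⟩
  let base : PolygonSurface k := ⟨fun _ => o, hvert _ ⟨0, fun _ _ => ho⟩⟩
  -- A vertex is moved to the base point by changing one coordinate after the other.
  have h1 : ∀ (S : Finset (Fin (k + 3))) (x : PolygonSurface k), (∀ j, x.1 j ∈ zeroSphere) →
      (∀ j ∉ S, x.1 j = o) → connectedComponent x = connectedComponent base := by
    intro S
    induction S using Finset.induction with
    | empty =>
      intro x _ h
      rw [show x = base from Subtype.ext (funext fun j => h j (by simp))]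
    | insert i S hi ih =>
      intro x hx h
      have hu : ∀ s, Function.update x.1 i s ∈ polyhedralProduct (polygonBoundary (k + 3))
          (fun _ => OneDisc) (fun _ => zeroSphere) := fun s =>
        hvert _ ⟨i, fun j hj => by rw [Function.update_of_ne hj]; exact hx j⟩
      have h2 := connectedComponent_update hu (x.1 i) o
      simp only [Function.update_eq_self] at h2
      refine h2.trans (ih _ (fun j => ?_) fun j hj => ?_)
      · by_cases hj : j = i
        · subst hj
          simpa using ho
        · simpa [hj] using hx j
      · by_cases hj' : j = i
        · subst hj'
          simp
        · simpa [hj'] using h j (by simp [hj, hj'])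
  have h2 : ∀ (i : Fin (k + 3)) (x : PolygonSurface k), (∀ j, j ≠ i → x.1 j ∈ zeroSphere) →
      connectedComponent x = connectedComponent base := by
    intro i x hx
    have hu : ∀ s, Function.update x.1 i s ∈ polyhedralProduct (polygonBoundary (k + 3))
        (fun _ => OneDisc) (fun _ => zeroSphere) := fun s =>
      hvert _ ⟨i, fun j hj => by rw [Function.update_of_ne hj]; exact hx j hj⟩
    have h2 := connectedComponent_update hu (x.1 i) o
    simp only [Function.update_eq_self] at h2
    refine h2.trans (h1 Finset.univ _ (fun j => ?_) (by simp))
    by_cases hj : j = i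
    · subst hj
      simpa using ho
    · simpa [hj] using hx j hj
  have h3 : ∀ x : PolygonSurface k, connectedComponent x = connectedComponent base := by
    intro x
    obtain ⟨i, hx⟩ := mem_polygonMomentAngle.1 x.2
    have hu : ∀ s, Function.update x.1 i s ∈ polyhedralProduct (polygonBoundary (k + 3))
        (fun _ => OneDisc) (fun _ => zeroSphere) := fun s =>
      mem_polygonMomentAngle.2 ⟨i, fun j hj hj' => by
        rw [Function.update_of_ne hj]
        exact hx j hj hj'⟩
    have h2' := connectedComponent_update hu (x.1 i) o
    simp only [Function.update_eq_self] at h2'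
    refine h2'.trans (h2 (i + 1) _ fun j hj => ?_)
    by_cases hj' : j = i
    · subst hj'
      simpa using ho
    · simpa [hj'] using hx j hj' hj
  refine connectedSpace_iff_connectedComponent.2 ⟨base, Set.eq_univ_of_forall fun x => ?_⟩
  rw [← h3 x]
  exact mem_connectedComponent

theorem isClosedOrientableSurface_polygonSurface (k : ℕ) :
    IsClosedOrientableSurface (PolygonSurface k) where
  compact := compactSpace_polygonSurface k
  connected := connectedSpace_polygonSurface k
  hausdorff := inferInstance
  oriented_atlas := by
    let := polygonSurfaceCharts k
    refine ⟨polygonSurfaceCharts k, isManifold_of_contDiffOn _ _ _ ?_, ?_⟩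
    · rintro e e' ⟨v, rfl⟩ ⟨v', rfl⟩ x hx
      exact (orientedChart_transition v v' hx.1).1.contDiffWithinAt
    · rintro e ⟨v, rfl⟩ e' ⟨v', rfl⟩ x hx
      exact (orientedChart_transition v v' hx).2

/-! ### Counting the simplices of a polygon -/

lemma card_le_two_of_mem_polygonBoundary {n : ℕ} {σ : Finset (Fin n)}
    (h : σ ∈ (polygonBoundary n).simplices) : σ.card ≤ 2 := by
  rcases h with rfl | ⟨i, rfl⟩ | ⟨i, j, -, rfl⟩
  · simp
  · simp
  · exact Finset.card_le_two

lemma numSimplices_neg_one {V : Type*} (K : PreAbstractSimplicialComplex V) :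
    K.numSimplices (-1) = 1 := by
  have : {σ : Finset V | σ ∈ K.simplices ∧ (σ.card : ℤ) = -1 + 1} = {∅} := by
    ext σ
    simp only [Set.mem_ofPred_eq, Set.mem_singleton_iff]
    constructor
    · rintro ⟨-, h⟩
      exact Finset.card_eq_zero.1 (by omega)
    · rintro rfl
      exact ⟨Or.inl rfl, by simp⟩
  rw [PreAbstractSimplicialComplex.numSimplices, this, Set.ncard_singleton]

lemma numSimplices_polygonBoundary_zero (n : ℕ) : (polygonBoundary n).numSimplices 0 = n := by
  have : {σ : Finset (Fin n) | σ ∈ (polygonBoundary n).simplices ∧ (σ.card : ℤ) = 0 + 1} =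
      Set.range fun i : Fin n => ({i} : Finset (Fin n)) := by
    ext σ
    simp only [Set.mem_ofPred_eq, Set.mem_range]
    constructor
    · rintro ⟨-, h⟩
      obtain ⟨i, rfl⟩ := Finset.card_eq_one.1 (by exact_mod_cast h : σ.card = 1)
      exact ⟨i, rfl⟩
    · rintro ⟨i, rfl⟩
      exact ⟨Or.inr (Or.inl ⟨i, rfl⟩), by simp⟩
  rw [PreAbstractSimplicialComplex.numSimplices, this, ← Set.image_univ,
    Set.ncard_image_of_injective _ Finset.singleton_injective, Set.ncard_univ, Nat.card_fin]

lemma numSimplices_polygonBoundary_one (k : ℕ) :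
    (polygonBoundary (k + 3)).numSimplices 1 = k + 3 := by
  have h : {σ : Finset (Fin (k + 3)) | σ ∈ (polygonBoundary (k + 3)).simplices ∧
      (σ.card : ℤ) = 1 + 1} = Set.range fun i : Fin (k + 3) => ({i, i + 1} : Finset _) := by
    ext σ
    simp only [Set.mem_ofPred_eq, Set.mem_range]
    constructor
    · rintro ⟨rfl | ⟨i, rfl⟩ | ⟨i, j, hij, rfl⟩, h⟩
      · simp at h
      · simp at h
      · rcases SimpleGraph.cycleGraph_adj.1 hij with e | e
        · obtain rfl := sub_eq_iff_eq_add'.1 e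
          exact ⟨j, Finset.pair_comm _ _⟩
        · obtain rfl := sub_eq_iff_eq_add'.1 e
          exact ⟨i, rfl⟩
    · rintro ⟨i, rfl⟩
      refine ⟨Or.inr (Or.inr ⟨i, i + 1, SimpleGraph.cycleGraph_adj.2 (Or.inr
        (add_sub_cancel_left _ _)), rfl⟩), ?_⟩
      rw [Finset.card_pair (fin_add_one_ne i).symm]
      norm_num
  have hinj : Function.Injective fun i : Fin (k + 3) => ({i, i + 1} : Finset (Fin (k + 3))) := by
    intro i j hij
    have hi : i ∈ ({j, j + 1} : Finset (Fin (k + 3))) := by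
      rw [← show ({i, i + 1} : Finset (Fin (k + 3))) = {j, j + 1} from hij]
      simp
    have hi' : i + 1 ∈ ({j, j + 1} : Finset (Fin (k + 3))) := by
      rw [← show ({i, i + 1} : Finset (Fin (k + 3))) = {j, j + 1} from hij]
      simp
    simp only [Finset.mem_insert, Finset.mem_singleton] at hi hi'
    rcases hi with rfl | rfl
    · rfl
    · rcases hi' with e | e
      · refine (fin_sub_one_ne_add_one (j + 1) ?_).elim
        rw [add_sub_cancel_right]
        exact e.symm
      · exact (fin_add_one_ne _ e).elim
  rw [PreAbstractSimplicialComplex.numSimplices, h, ← Set.image_univ,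
    Set.ncard_image_of_injective _ hinj, Set.ncard_univ, Nat.card_fin]

lemma numSimplices_polygonBoundary_of_two_le (n : ℕ) {l : ℤ} (hl : 2 ≤ l) :
    (polygonBoundary n).numSimplices l = 0 := by
  have : {σ : Finset (Fin n) | σ ∈ (polygonBoundary n).simplices ∧ (σ.card : ℤ) = l + 1} = ∅ := by
    refine Set.eq_empty_of_forall_notMem fun σ ⟨h, h'⟩ => ?_
    have := card_le_two_of_mem_polygonBoundary h
    omega
  rw [PreAbstractSimplicialComplex.numSimplices, this, Set.ncard_empty]

lemma sum_numSimplices_polygonBoundary (k : ℕ) :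
    ∑ l ∈ Finset.range (k + 3 + 1),
      (-1 : ℤ) ^ l * ((polygonBoundary (k + 3)).numSimplices ((l : ℤ) - 1) : ℤ) *
        2 ^ (k + 3 - l) = 2 - 2 * (1 + ((k : ℤ) - 1) * 2 ^ k) := by
  have h3 : Finset.range 3 ⊆ Finset.range (k + 3 + 1) := Finset.range_subset_range.2 (by omega)
  rw [← Finset.sum_subset h3 fun l _ hl => ?_]
  · rw [Finset.sum_range_succ, Finset.sum_range_succ, Finset.sum_range_one]
    have e0 : ((0 : ℕ) : ℤ) - 1 = -1 := by norm_num
    have e1 : ((1 : ℕ) : ℤ) - 1 = 0 := by norm_num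
    have e2 : ((2 : ℕ) : ℤ) - 1 = 1 := by norm_num
    rw [e0, e1, e2, numSimplices_neg_one, numSimplices_polygonBoundary_zero,
      numSimplices_polygonBoundary_one, show k + 3 - 0 = k + 3 by omega,
      show k + 3 - 1 = k + 2 by omega, show k + 3 - 2 = k + 1 by omega]
    push_cast
    ring
  · rw [Finset.mem_range, not_lt] at hl
    rw [numSimplices_polygonBoundary_of_two_le _ (by omega)]
    simp

theorem proposition3p11 :
    (∀ (m : ℕ) (K : PreAbstractSimplicialComplex (Fin m)),
      HasFiniteHomology (RealMomentAngleComplex K) ∧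
      eulerCharacteristic (RealMomentAngleComplex K) =
        ∑ k ∈ Finset.range (m + 1),
          (-1 : ℤ) ^ k * (K.numSimplices ((k : ℤ) - 1) : ℤ) * 2 ^ (m - k)) ∧
    (∀ n : ℕ, 3 ≤ n → ∃ g : ℕ,
      (g : ℤ) = 1 + ((n : ℤ) - 4) * 2 ^ (n - 3) ∧
      IsSurfaceOfGenus (RealMomentAngleComplex (polygonBoundary n)) g) := by
  refine ⟨fun m K => hasEuler_realMomentAngleComplex K, fun n hn => ?_⟩
  obtain ⟨k, rfl⟩ := Nat.exists_eq_add_of_le' hn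
  have hg : (0 : ℤ) ≤ 1 + ((k : ℤ) - 1) * 2 ^ k := by
    rcases Nat.eq_zero_or_pos k with rfl | hk
    · simp
    · have : (0 : ℤ) ≤ (k : ℤ) - 1 := by omega
      positivity
  obtain ⟨g, hg⟩ := Int.eq_ofNat_of_zero_le hg
  obtain ⟨h1, h2⟩ := hasEuler_realMomentAngleComplex (polygonBoundary (k + 3))
  refine ⟨g, ?_, isClosedOrientableSurface_polygonSurface k, h1, ?_⟩
  · rw [← hg, Nat.add_sub_cancel]
    push_cast
    ring
  · rw [h2, sum_numSimplices_polygonBoundary, hg]
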